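/- Let $\mathcal X,\mathcal S$ be finite alphabets and $\mathcal H_B$ a finite-dimensional Hilbert space. A sequence of classical-quantum Gel'fand–Pinsker channels consists, for every $n$, of an arbitrary probability distribution $p_{S^n}$ on $\mathcal S^n$ and density matrices $\rho^{B^n}_{x^n,s^n}$ on $\mathcal H_B^{\otimes n}$ ($x^n\in\mathcal X^n$, $s^n\in\mathcal S^n$); no stationarity or memorylessness is assumed. An $(n,M_n,M_{e,n},\varepsilon_n)$ code consists of a state encoding $f_{e,n}:\mathcal S^n\to[1:M_{e,n}]$, a (possibly randomized) encoding $f_n:[1:M_n]\times[1:M_{e,n}]\to\mathcal X^n$ and a decoding POVM $\{\beta(m)\}_{m\in[1:M_n]}$ on $\mathcal H_B^{\otimes n}$ with $$\frac1{M_n}\sum_{m=1}^{M_n}\sum_{s^n}p_{S^n}(s^n)\,\mathbb E\,\mathrm{Tr}\big[(\mathbb I-\beta(m))\,\rho^{B^n}_{f_n(m,f_{e,n}(s^n)),s^n}\big]\le\varepsilon_n,$$ the expectation being over the randomness of $f_n$. A pair $(R,R_S)$ of real numbers is achievable if for every $\varepsilon>0$ there is a sequence of $(n,M_n,M_{e,n},\varepsilon_n)$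 codes with $\liminf_n\frac1n\log_2M_n>R$, $\limsup_n\varepsilon_n<\varepsilon$ and $\limsup_n\frac1n\log_2M_{e,n}<R_S$. The capacity region is the closure in $\mathbb R^2$ of the set of achievable pairs. For a sequence of pairs of finitely-valued random variables $(A_n,C_n)$ with joint distributions $p_{A_nC_n}$ let $$\overline{\mathbf I}[\mathbf A;\mathbf C]=\inf\Big\{a\in\mathbb R:\ \lim_{n\to\infty}\Pr\Big\{\tfrac1n\log_2\tfrac{p_{A_nC_n}(A_n,C_n)}{p_{A_n}(A_n)p_{C_n}(C_n)}>a+\gamma\Big\}=0\ \text{ for all }\gamma>0\Big\},$$ and for sequences of density matrices $\rho_n,\sigma_n$ let $$\underline{\mathbf I}[\boldsymbol\rho;\boldsymbol\sigma]=\sup\Big\{a\in\mathbb R:\ \lim_{n\to\infty}\mathrm{Tr}\big[\{\rho_n\succeq2^{n(a-\gamma)}\sigma_n\}\rho_n\big]=1\ \text{ for all }\gamma>0\Big\},$$ both in $[-\infty,\infty]$, where $\{\rho_n\succeq c\,\sigma_n\}$ is the projection onto the nonnegative eigenspace of $\rho_n-c\,\sigma_n$. Consider all sequences of states of the form $$\Theta^{S^n\tilde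 S^nU^nX^nB^n}=\sum_{s^n,\tilde s^n,u^n,x^n}p_{S^n}(s^n)\,p_{\tilde S^n|S^n}(\tilde s^n|s^n)\,p_{U^n|\tilde S^n}(u^n|\tilde s^n)\,p_{X^n|U^n\tilde S^n}(x^n|u^n,\tilde s^n)\ |s^n\rangle\langle s^n|\otimes|\tilde s^n\rangle\langle\tilde s^n|\otimes|u^n\rangle\langle u^n|\otimes|x^n\rangle\langle x^n|\otimes\rho^{B^n}_{x^n,s^n},$$ where, for each $n$, $\tilde S^n$ and $U^n$ take values in arbitrary finite sets and the conditional distributions are arbitrary. Put $\underline{\mathbf I}[\mathbf U;\mathbf B]=\underline{\mathbf I}[\{\Theta^{U^nB^n}\};\{\Theta^{U^n}\otimes\Theta^{B^n}\}]$, and compute $\overline{\mathbf I}[\mathbf U;\tilde{\mathbf S}]$ and $\overline{\mathbf I}[\mathbf S;\tilde{\mathbf S}]$ from the corresponding marginal distributions. Theorem. The capacity region is exactly the set of all pairs $(R,R_S)\in\mathbb R^2$ for which there is such a sequence of states satisfying both $$R\le\underline{\mathbf I}[\mathbf U;\mathbf B]-\overline{\mathbf I}[\mathbf U;\tilde{\mathbf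 S}],\qquad R_S\ge\overline{\mathbf I}[\mathbf S;\tilde{\mathbf S}].$$ -/

import Mathlib

open Filter Topology Matrix
open scoped Kronecker ComplexOrder

namespace CQGP

noncomputable section

/-! ### Information-spectrum quantities -/

/-- First marginal of a joint probability mass function. -/
def marginalFst {A C : Type*} [Fintype C] (p : A → C → ℝ) (a : A) : ℝ := ∑ c, p a c

/-- Second marginal of a joint probability mass function. -/
def marginalSnd {A C : Type*} [Fintype A] (p : A → C → ℝ) (c : C) : ℝ := ∑ a, p a c

open Classical in
/-- The probability, under the joint distribution `p`, that the normalized information density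
`(1/n) log₂ (p(a,c) / (p(a) p(c)))` exceeds `x`. Pairs of probability zero do not contribute, and
for all others the marginals are positive. -/
def probInfoDensityGT {A C : Type*} [Fintype A] [Fintype C] (n : ℕ) (p : A → C → ℝ) (x : ℝ) : ℝ :=
  ∑ a, ∑ c, if x < (1 / (n : ℝ)) * Real.logb 2 (p a c / (marginalFst p a * marginalSnd p c))
    then p a c else 0

/-- Spectral-sup mutual information rate of a sequence of joint distributions, as an extended
real (it is `⊤` when no real number `a` is admissible). -/
def spectralSupInfo {A C : ℕ → Type*} [∀ n, Fintype (A n)] [∀ n, Fintype (C n)]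
    (p : ∀ n, A n → C n → ℝ) : EReal :=
  sInf {e : EReal | ∃ a : ℝ, e = (a : EReal) ∧
    ∀ γ : ℝ, 0 < γ → Tendsto (fun n : ℕ => probInfoDensityGT n (p n) (a + γ)) atTop (𝓝 0)}

/-- For a Hermitian matrix `A`, the orthogonal projection `{A ⪰ 0}` onto the span of the
eigenvectors of `A` with nonnegative eigenvalue. -/
def nonnegProj {ι : Type*} [Fintype ι] [DecidableEq ι] (A : Matrix ι ι ℂ) : Matrix ι ι ℂ :=
  cfc (Set.indicator (Set.Ici (0 : ℝ)) (fun _ => (1 : ℝ))) A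

/-- Spectral-inf information rate of a sequence of density matrices `ρ` with respect to `σ`, as an
extended real. -/
def spectralInfInfo {ι : ℕ → Type*} [∀ n, Fintype (ι n)] [∀ n, DecidableEq (ι n)]
    (ρ σ : ∀ n, Matrix (ι n) (ι n) ℂ) : EReal :=
  sSup {e : EReal | ∃ a : ℝ, e = (a : EReal) ∧ ∀ γ : ℝ, 0 < γ →
    Tendsto (fun n : ℕ => (trace
      (nonnegProj (ρ n - ((2 : ℝ) ^ ((n : ℝ) * (a - γ))) • σ n) * ρ n)).re) atTop (𝓝 1)}

/-! ### Channels and codes -/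

/-- A sequence of classical-quantum Gel'fand-Pinsker channels with state. For every blocklength
`n`, `stateDist n` is an arbitrary distribution of the state sequence, and `out x s` is a density
matrix on the `n`-fold tensor power of the output space; `B` indexes an orthonormal basis of the
output space, hence `Fin n → B` the product basis of its `n`-fold tensor power. -/
structure ChannelSeq (X S B : Type*) [Fintype S] [Fintype B] where
  /-- distribution of the state sequence -/
  stateDist : ∀ n : ℕ, (Fin n → S) → ℝ
  stateDist_mem : ∀ n, stateDist n ∈ stdSimplex ℝ (Fin n → S)
  /-- output state for input sequence `x` and state sequence `s` -/
  out : ∀ {n : ℕ}, (Fin n → X) → (Fin n → S) → Matrix (Fin n → B) (Fin n → B) ℂ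
  out_posSemidef : ∀ {n : ℕ} (x : Fin n → X) (s : Fin n → S), (out x s).PosSemidef
  out_trace : ∀ {n : ℕ} (x : Fin n → X) (s : Fin n → S), (out x s).trace = 1

/-- A code of blocklength `n`: `M` messages, state-encoder `stateEnc` with `Me` values, randomized
encoder `enc`, and decoding POVM `povm`. -/
structure Code (X S B : Type*) [Fintype X] [Fintype B] [DecidableEq B] (n : ℕ) where
  /-- number of messages -/
  M : ℕ
  M_pos : 0 < M
  /-- number of values of the coded state information -/
  Me : ℕ
  Me_pos : 0 < Me
  /-- state encoding -/
  stateEnc : (Fin n → S) → Fin Me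
  /-- `enc m k x` is the probability that the input `x` is sent given `m` and `k` -/
  enc : Fin M → Fin Me → (Fin n → X) → ℝ
  enc_mem : ∀ m k, enc m k ∈ stdSimplex ℝ (Fin n → X)
  /-- decoding measurement -/
  povm : Fin M → Matrix (Fin n → B) (Fin n → B) ℂ
  povm_posSemidef : ∀ m, (povm m).PosSemidef
  povm_sum : ∑ m, povm m = 1

variable {X S B : Type*} [Fintype X] [DecidableEq X] [Fintype S] [DecidableEq S]
  [Fintype B] [DecidableEq B]

/-- Error probability of a code, averaged over uniform messages, the state sequence and the
randomness of the encoder. -/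
def Code.error {n : ℕ} (C : Code X S B n) (N : ChannelSeq X S B) : ℝ :=
  (1 / (C.M : ℝ)) * ∑ m, ∑ s, N.stateDist n s *
    ∑ x, C.enc m (C.stateEnc s) x * (trace ((1 - C.povm m) * N.out x s)).re

/-- Achievable rate pairs: for every `ε > 0` there is a sequence of `(n, M_n, M_{e,n}, ε_n)` codes
with `liminf (1/n) log₂ M_n > R`, `limsup ε_n < ε` and `limsup (1/n) log₂ M_{e,n} < R_S`. -/
def Achievable (N : ChannelSeq X S B) (R RS : ℝ) : Prop :=
  ∀ ε : ℝ, 0 < ε → ∃ (C : ∀ n, Code X S B n) (e : ℕ → ℝ),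
    (∀ n, (C n).error N ≤ e n) ∧
    (R : EReal) < liminf (fun n : ℕ => (((1 / (n : ℝ)) * Real.logb 2 (C n).M : ℝ) : EReal)) atTop ∧
    limsup (fun n : ℕ => (e n : EReal)) atTop < (ε : EReal) ∧
    limsup (fun n : ℕ => (((1 / (n : ℝ)) * Real.logb 2 (C n).Me : ℝ) : EReal)) atTop < (RS : EReal)

/-- Capacity region: the closure in `ℝ × ℝ` of the set of achievable rate pairs. -/
def capacityRegion (N : ChannelSeq X S B) : Set (ℝ × ℝ) :=
  closure {r : ℝ × ℝ | Achievable N r.1 r.2}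

/-! ### Classical-quantum states of Markov form -/

/-- Conditional distributions `p(s̃|s)`, `p(u|s̃)`, `p(x|u,s̃)` at blocklength `n`, with finite
auxiliary alphabets `T` (for `s̃`) and `U`. -/
structure AuxKernels (X S : Type*) [Fintype X] (T U : Type*) [Fintype T] [Fintype U] (n : ℕ) where
  /-- `pT s t` is `p(s̃ = t | s)` -/
  pT : (Fin n → S) → T → ℝ
  pT_mem : ∀ s, pT s ∈ stdSimplex ℝ T
  /-- `pU t u` is `p(u | s̃ = t)` -/
  pU : T → U → ℝ
  pU_mem : ∀ t, pU t ∈ stdSimplex ℝ U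
  /-- `pX u t x` is `p(x | u, s̃ = t)` -/
  pX : U → T → (Fin n → X) → ℝ
  pX_mem : ∀ u t, pX u t ∈ stdSimplex ℝ (Fin n → X)

namespace AuxKernels

variable {T U : Type*} [Fintype T] [DecidableEq T] [Fintype U] [DecidableEq U] {n : ℕ}

/-- Joint distribution `p(s) p(s̃|s) p(u|s̃) p(x|u,s̃)`. -/
def joint (N : ChannelSeq X S B) (P : AuxKernels X S T U n)
    (s : Fin n → S) (t : T) (u : U) (x : Fin n → X) : ℝ :=
  N.stateDist n s * P.pT s t * P.pU t u * P.pX u t x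

/-- Joint distribution of `(S^n, S̃^n)`. -/
def jointST (N : ChannelSeq X S B) (P : AuxKernels X S T U n) (s : Fin n → S) (t : T) : ℝ :=
  ∑ u, ∑ x, P.joint N s t u x

/-- Joint distribution of `(U^n, S̃^n)`. -/
def jointUT (N : ChannelSeq X S B) (P : AuxKernels X S T U n) (u : U) (t : T) : ℝ :=
  ∑ s, ∑ x, P.joint N s t u x

/-- The state `Θ` on `S^n S̃^n U^n X^n B^n`; `Matrix.single a a 1` is `|a⟩⟨a|`. -/
def state (N : ChannelSeq X S B) (P : AuxKernels X S T U n) :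
    Matrix ((Fin n → S) × T × U × (Fin n → X) × (Fin n → B))
      ((Fin n → S) × T × U × (Fin n → X) × (Fin n → B)) ℂ :=
  ∑ s, ∑ t, ∑ u, ∑ x, P.joint N s t u x •
    (single s s (1 : ℂ) ⊗ₖ (single t t (1 : ℂ) ⊗ₖ (single u u (1 : ℂ) ⊗ₖ
      (single x x (1 : ℂ) ⊗ₖ N.out x s))))

/-- The reduced state on `U^n B^n` (partial trace over `S^n`, `S̃^n`, `X^n`). -/
def stateUB (N : ChannelSeq X S B) (P : AuxKernels X S T U n) :
    Matrix (U × (Fin n → B)) (U × (Fin n → B)) ℂ :=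
  of fun i j => ∑ s, ∑ t, ∑ x, P.state N (s, t, i.1, x, i.2) (s, t, j.1, x, j.2)

/-- The reduced state on `U^n`. -/
def stateU (N : ChannelSeq X S B) (P : AuxKernels X S T U n) : Matrix U U ℂ :=
  of fun u u' => ∑ b, P.stateUB N (u, b) (u', b)

/-- The reduced state on `B^n`. -/
def stateB (N : ChannelSeq X S B) (P : AuxKernels X S T U n) :
    Matrix (Fin n → B) (Fin n → B) ℂ :=
  of fun b b' => ∑ u, P.stateUB N (u, b) (u, b')

end AuxKernels

/-- The spectral-inf quantum mutual information rate between `U` and `B`, i.e. that of the states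
`Θ^{UB}` with respect to `Θ^U ⊗ Θ^B`. -/
def infoUB (N : ChannelSeq X S B) {T U : ℕ → Type*} [∀ n, Fintype (T n)] [∀ n, DecidableEq (T n)]
    [∀ n, Fintype (U n)] [∀ n, DecidableEq (U n)]
    (P : ∀ n, AuxKernels X S (T n) (U n) n) : EReal :=
  spectralInfInfo (fun n => (P n).stateUB N) (fun n => (P n).stateU N ⊗ₖ (P n).stateB N)

/-- The spectral-sup mutual information rate between `U` and `S̃`. -/
def infoUT (N : ChannelSeq X S B) {T U : ℕ → Type*} [∀ n, Fintype (T n)] [∀ n, Fintype (U n)]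
    (P : ∀ n, AuxKernels X S (T n) (U n) n) : EReal :=
  spectralSupInfo (fun n => (P n).jointUT N)

/-- The spectral-sup mutual information rate between `S` and `S̃`. -/
def infoST (N : ChannelSeq X S B) {T U : ℕ → Type*} [∀ n, Fintype (T n)] [∀ n, Fintype (U n)]
    (P : ∀ n, AuxKernels X S (T n) (U n) n) : EReal :=
  spectralSupInfo (fun n => (P n).jointST N)

end

end CQGP

namespace CQGP


/-! ### Positive semidefinite matrices -/

section PosSemidef

variable {ι : Type*} [Fintype ι]

/-! Converse. A code induces auxiliary variables: S̃ is the coded state, U the uniform message, X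
the encoder output. U is independent of S̃, so the rate between them is at most 0. Since S̃ takes
only `Me` values, its information density with S exceeds x with probability at most `Me` · 2^(-nx)
(`probInfoDensityGT_le_card_mul`). The event "the decoder outputs U" is a test accepting Θ^{UB} with
probability 1 - error and Θ^U ⊗ Θ^B with probability 1/M. Spectral projections are optimal tests
(`trace_le_nonnegProj_trace`), so the rate between U and B is at least that of M. A diagonal
argument merges the codes for all ε.

Direct part. There are two random codebooks: about 2^(nc) words t drawn from p(s̃), and for each
message about 2^(nb) words u drawn from p(u). Rejection sampling replaces joint typicality and a
Markov lemma. To imitate v by samples of q, accept y with probability v(y)/(K q(y)) where this ratio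
is at most 1. An accepted sample has density at most v/K, so L·K samples cost at most L times the
cost under v. All are rejected with probability at most e^(-L) plus the mass where v > K q, which on
average is a tail of the information density. An encoder choosing a cheapest word does at least as
well, so each layer multiplies the ideal error only by a constant: `exists_covering_codebook` for t,
`exists_packing_codebook` for u.

The decoder is the square-root measurement built from the blocks of {Θ^{UB} ⪰ 2^(na) Θ^U ⊗ Θ^B}. By
`hayashi_nagaoka` its error is controlled by the missed detection of Θ^{UB} and by the number of
codewords times the false-alarm probability 2^(-na). This vanishes when R + b < a. Then L is taken
large. -/

theorem posSemidef_mul_self {A : Matrix ι ι ℂ} (hA : A.IsHermitian) : (A * A).PosSemidef := by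
  have h := posSemidef_conjTranspose_mul_self A
  rwa [hA.eq] at h

theorem posSemidef_of_idempotent {A : Matrix ι ι ℂ} (hA : A.IsHermitian) (h : A * A = A) :
    A.PosSemidef := h ▸ posSemidef_mul_self hA

variable [DecidableEq ι]

theorem continuousOn_spectrum {A : Matrix ι ι ℂ} (hA : A.IsHermitian) (f : ℝ → ℝ) :
    ContinuousOn f (spectrum ℝ A) :=
  (hA.spectrum_real_eq_range_eigenvalues ▸ Set.finite_range _ : (spectrum ℝ A).Finite).continuousOn f

theorem isHermitian_cfc (A : Matrix ι ι ℂ) (f : ℝ → ℝ) : (cfc f A).IsHermitian :=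
  cfc_predicate f A

theorem PosSemidef.exists_sqrt {A : Matrix ι ι ℂ} (hA : A.PosSemidef) :
    ∃ R : Matrix ι ι ℂ, R.PosSemidef ∧ R * R = A := by
  have hc := continuousOn_spectrum hA.isHermitian
  have hs : ∀ x ∈ spectrum ℝ A, 0 ≤ x := by
    intro x hx
    rw [hA.isHermitian.spectrum_real_eq_range_eigenvalues] at hx
    obtain ⟨i, rfl⟩ := hx
    exact hA.eigenvalues_nonneg i
  have key : ∀ f g : ℝ → ℝ, (∀ x, 0 ≤ x → f x * f x = g x) → cfc f A * cfc f A = cfc g A := by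
    intro f g hfg
    rw [← cfc_mul f f A (hc _) (hc _)]
    exact cfc_congr fun x hx => hfg x (hs x hx)
  refine ⟨cfc (fun x => √x) A, ?_, ?_⟩
  -- The root is the square of the fourth root, hence positive semidefinite.
  · rw [← key (fun x => √(√x)) (fun x => √x) fun x _ => Real.mul_self_sqrt (Real.sqrt_nonneg x)]
    exact posSemidef_mul_self (isHermitian_cfc _ _)
  · rw [key _ (fun x => x) fun x hx => Real.mul_self_sqrt hx]
    exact cfc_id' ℝ A hA.isHermitian

theorem trace_mul_re_nonneg {A B : Matrix ι ι ℂ} (hA : A.PosSemidef) (hB : B.PosSemidef) :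
    0 ≤ (trace (A * B)).re := by
  obtain ⟨R, hR, rfl⟩ := PosSemidef.exists_sqrt hA
  have h := (hB.conjTranspose_mul_mul_same R).trace_nonneg
  rw [hR.isHermitian.eq, trace_mul_comm, ← Matrix.mul_assoc] at h
  exact (Complex.nonneg_iff.mp h).1

theorem trace_mul_re_mono {A B C : Matrix ι ι ℂ} (h : (B - A).PosSemidef) (hC : C.PosSemidef) :
    (trace (A * C)).re ≤ (trace (B * C)).re := by
  have := trace_mul_re_nonneg h hC
  rw [Matrix.sub_mul, trace_sub, Complex.sub_re] at this
  linarith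

/-- Operator monotonicity of the square root, in the form `S² ≤ R² → S ≤ R`. -/
theorem posSemidef_sub_of_sq {R S : Matrix ι ι ℂ} (hR : R.PosSemidef) (hS : S.IsHermitian)
    (h : (R * R - S * S).PosSemidef) : (R - S).PosSemidef := by
  have hH : (R - S).IsHermitian := hR.isHermitian.sub hS
  refine hH.posSemidef_iff_eigenvalues_nonneg.mpr fun i => ?_
  -- For an eigenvector v of R - S with eigenvalue l < 0, Sv = Rv - lv, so ⟨v, (R² - S²)v⟩ = 2l⟨v,
  -- Rv⟩ - l²‖v‖² < 0.
  by_contra! hneg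
  set l := hH.eigenvalues i with hl
  set v : ι → ℂ := WithLp.ofLp (hH.eigenvectorBasis i) with hv
  have hev : (R - S) *ᵥ v = (l : ℂ) • v := by
    have := hH.mulVec_eigenvectorBasis i
    simpa using this
  have hv0 : v ≠ 0 := by
    intro h0
    have := hH.eigenvectorBasis.toBasis.ne_zero i
    apply this
    ext j
    simpa [hv] using congrFun h0 j
  have hSv : S *ᵥ v = R *ᵥ v - (l : ℂ) • v := by
    rw [← hev, Matrix.sub_mulVec]; abel
  have hherm : ∀ {T : Matrix ι ι ℂ}, T.IsHermitian →
      star v ⬝ᵥ ((T * T) *ᵥ v) = star (T *ᵥ v) ⬝ᵥ (T *ᵥ v) := by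
    intro T hT
    rw [star_mulVec, hT.eq, ← Matrix.dotProduct_mulVec, Matrix.mulVec_mulVec]
  have h1 := h.dotProduct_mulVec_nonneg v
  rw [Matrix.sub_mulVec, dotProduct_sub, hherm hR.isHermitian, hherm hS, hSv] at h1
  have h2 := hR.dotProduct_mulVec_nonneg v
  have h3 : star (R *ᵥ v) ⬝ᵥ v = star v ⬝ᵥ (R *ᵥ v) := by
    rw [star_mulVec, hR.isHermitian.eq, ← Matrix.dotProduct_mulVec]
  have h4 : 0 < star v ⬝ᵥ v := dotProduct_star_self_pos_iff.mpr hv0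
  simp only [star_sub, star_smul, sub_dotProduct, dotProduct_sub, smul_dotProduct,
    dotProduct_smul, h3, Complex.star_def, Complex.conj_ofReal, smul_eq_mul] at h1
  obtain ⟨h1, -⟩ := Complex.nonneg_iff.mp h1
  obtain ⟨h2, -⟩ := Complex.nonneg_iff.mp h2
  obtain ⟨h4, -⟩ := Complex.pos_iff.mp h4
  simp at h1
  nlinarith [mul_pos (mul_pos_of_neg_of_neg hneg hneg) h4, mul_nonneg (neg_nonneg.mpr hneg.le) h2]

theorem posSemidef_sub_mul_self {S : Matrix ι ι ℂ} (hS : S.PosSemidef)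
    (hS1 : (1 - S).PosSemidef) : (S - S * S).PosSemidef := by
  obtain ⟨Q, hQ, hQS⟩ := PosSemidef.exists_sqrt hS
  have h := hS1.conjTranspose_mul_mul_same Q
  rw [hQ.isHermitian.eq] at h
  convert h using 1
  rw [← hQS]
  noncomm_ring

/-- The Hayashi-Nagaoka inequality: with `G = (S + T)^{-1/2}` one has
`1 - G S G ≤ 2 (1 - S) + 4 T`. -/
theorem hayashi_nagaoka {R G S T : Matrix ι ι ℂ} (hR : R.PosSemidef) (hG : G.IsHermitian)
    (hRG : R * G = 1) (hGR : G * R = 1) (hS : S.PosSemidef) (hS1 : (1 - S).PosSemidef)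
    (hT : T.PosSemidef) (hsum : R * R = S + T) :
    ((2 : ℝ) • (1 - S) + (4 : ℝ) • T - (1 - G * S * G)).PosSemidef := by
  -- S² ≤ S ≤ S + T = R², and the square root is operator monotone.
  have hRS : (R - S).PosSemidef := by
    refine posSemidef_sub_of_sq hR hS.isHermitian ?_
    have := (posSemidef_sub_mul_self hS hS1).add hT
    rw [hsum]
    convert this using 1
    abel
  have hG1 : (G - 1).IsHermitian := hG.sub isHermitian_one
  have hG2 : (G - (2 : ℝ) • 1).IsHermitian := by
    refine hG.sub ?_
    rw [IsHermitian, conjTranspose_smul, conjTranspose_one, star_trivial]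
  have h1 := hS.conjTranspose_mul_mul_same (G - 1)
  have h2 := hT.conjTranspose_mul_mul_same (G - (2 : ℝ) • 1)
  rw [hG1.eq] at h1
  rw [hG2.eq] at h2
  -- The difference of the two sides equals 4(R - S) + 2(G - 1)S(G - 1) + (G - 2)T(G - 2), a sum of
  -- positive terms.
  have h := ((hRS.smul (show (0 : ℝ) ≤ 4 by norm_num)).add
    (h1.smul (show (0 : ℝ) ≤ 2 by norm_num))).add h2
  have hT' : T = R * R - S := by rw [hsum]; abel
  convert h using 1
  subst hT'
  have e1 : G * (R * R - S) * G = 1 - G * S * G := by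
    rw [Matrix.mul_sub, Matrix.sub_mul, ← Matrix.mul_assoc, hGR, Matrix.one_mul, hRG]
  have e2 : (R * R - S) * G = R - S * G := by
    rw [Matrix.sub_mul, Matrix.mul_assoc, hRG, Matrix.mul_one]
  have e3 : G * (R * R - S) = R - G * S := by
    rw [Matrix.mul_sub, ← Matrix.mul_assoc, hGR, Matrix.one_mul]
  have e4 : (G - (2 : ℝ) • 1) * (R * R - S) * (G - (2 : ℝ) • 1) =
      1 - G * S * G - (2 : ℝ) • (R - G * S) - (2 : ℝ) • (R - S * G) + (4 : ℝ) • (R * R - S) := by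
    rw [← e1, ← e2, ← e3]
    simp only [Matrix.sub_mul, Matrix.mul_sub, Matrix.smul_mul, Matrix.mul_smul, Matrix.one_mul,
      Matrix.mul_one, Matrix.mul_assoc]
    module
  have e5 : (G - 1) * S * (G - 1) = G * S * G - G * S - S * G + S := by noncomm_ring
  rw [e4, e5]
  module

end PosSemidef


/-! ### Square-root measurements and spectral projections. -/

section Measurement

variable {ι : Type*} [Fintype ι] [DecidableEq ι]

/-- The square-root measurement, with the tests of each message grouped together. The term δ·1 makes
the sum of the tests invertible, and assigning it to `m₀` makes the operators sum exactly to 1. -/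
theorem exists_povm_of_tests {M J : Type*} [Fintype M] [DecidableEq M] [Fintype J] [DecidableEq J]
    (m₀ : M) (Λ : M × J → Matrix ι ι ℂ) (h0 : ∀ i, (Λ i).PosSemidef)
    (h1 : ∀ i, (1 - Λ i).PosSemidef) {δ : ℝ} (hδ : 0 < δ) :
    ∃ β : M → Matrix ι ι ℂ, (∀ m, (β m).PosSemidef) ∧ ∑ m, β m = 1 ∧
      ∀ m j, ∀ ρ : Matrix ι ι ℂ, ρ.PosSemidef →
        (trace ((1 - β m) * ρ)).re ≤ 2 * (trace ((1 - Λ (m, j)) * ρ)).re +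
          4 * (∑ i ∈ Finset.univ.erase (m, j), (trace (Λ i * ρ)).re + δ * ρ.trace.re) := by
  have hδ1 : ((δ : ℝ) • (1 : Matrix ι ι ℂ)).PosDef := PosDef.one.smul hδ
  have hsum : (∑ i, Λ i).PosSemidef := posSemidef_sum _ fun i _ => h0 i
  set A : Matrix ι ι ℂ := ∑ i, Λ i + δ • 1 with hA
  have hApd : A.PosDef := PosDef.posSemidef_add hsum hδ1
  obtain ⟨R, hR, hRA⟩ := PosSemidef.exists_sqrt hApd.posSemidef
  have hRu : IsUnit R.det := by
    have : IsUnit (R * R).det := (Matrix.isUnit_iff_isUnit_det _).mp (hRA ▸ hApd.isUnit)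
    rw [det_mul] at this
    exact isUnit_of_mul_isUnit_left this
  have hRG : R * R⁻¹ = 1 := mul_nonsing_inv R hRu
  have hGR : R⁻¹ * R = 1 := nonsing_inv_mul R hRu
  have hG : R⁻¹.IsHermitian := hR.isHermitian.inv
  have hconj : ∀ {B : Matrix ι ι ℂ}, B.PosSemidef → (R⁻¹ * B * R⁻¹).PosSemidef := by
    intro B hB
    have := hB.conjTranspose_mul_mul_same R⁻¹
    rwa [hG.eq] at this
  have hind : ∀ m, ((if m = m₀ then δ else 0) • (1 : Matrix ι ι ℂ)).PosSemidef := fun m =>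
    PosSemidef.one.smul (by split_ifs <;> linarith)
  have hrow : ∀ m, (∑ j, Λ (m, j) + (if m = m₀ then δ else 0) • 1).PosSemidef := fun m =>
    (posSemidef_sum _ fun j _ => h0 _).add (hind m)
  refine ⟨fun m => R⁻¹ * (∑ j, Λ (m, j) + (if m = m₀ then δ else 0) • 1) * R⁻¹,
    fun m => hconj (hrow m), ?_, ?_⟩
  · rw [← Matrix.sum_mul, ← Matrix.mul_sum, Finset.sum_add_distrib, ← Finset.sum_smul,
      Finset.sum_ite_eq' Finset.univ m₀, if_pos (Finset.mem_univ _),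
      ← Fintype.sum_prod_type', ← hA, ← hRA, ← Matrix.mul_assoc, hGR, Matrix.one_mul, hRG]
  · intro m j ρ hρ
    set T : Matrix ι ι ℂ := ∑ i ∈ Finset.univ.erase (m, j), Λ i + δ • 1 with hT
    have hTp : T.PosSemidef := (posSemidef_sum _ fun i _ => h0 i).add hδ1.posSemidef
    have hsplit : R * R = Λ (m, j) + T := by
      rw [hRA, hA, hT, ← Finset.add_sum_erase _ _ (Finset.mem_univ (m, j)), add_assoc]
    have hHN := hayashi_nagaoka hR hG hRG hGR (h0 (m, j)) (h1 (m, j)) hTp hsplit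
    -- The remaining tests of the same message only enlarge β m, so β m dominates the piece coming
    -- from (m, j) alone.
    have hle : ((1 - R⁻¹ * Λ (m, j) * R⁻¹) -
        (1 - R⁻¹ * (∑ j, Λ (m, j) + (if m = m₀ then δ else 0) • 1) * R⁻¹)).PosSemidef := by
      have h : (∑ j' ∈ Finset.univ.erase j, Λ (m, j') +
          (if m = m₀ then δ else 0) • (1 : Matrix ι ι ℂ)).PosSemidef :=
        (posSemidef_sum _ fun j _ => h0 _).add (hind m)
      convert hconj h using 1
      rw [← Finset.add_sum_erase _ _ (Finset.mem_univ j)]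
      simp only [Matrix.mul_add, Matrix.add_mul]
      abel
    refine (trace_mul_re_mono hle hρ).trans ((trace_mul_re_mono hHN hρ).trans_eq ?_)
    rw [hT]
    simp only [Matrix.add_mul, Matrix.smul_mul, trace_add, trace_smul, Matrix.sum_mul, trace_sum,
      Complex.add_re, Complex.real_smul, Complex.re_ofReal_mul, Complex.re_sum, Matrix.one_mul]

/-! ### The projection onto the nonnegative eigenspace -/

theorem nonnegProj_mul_self {A : Matrix ι ι ℂ} (hA : A.IsHermitian) :
    nonnegProj A * nonnegProj A = nonnegProj A := by
  have hc := continuousOn_spectrum hA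
  rw [nonnegProj, ← cfc_mul _ _ A (hc _) (hc _)]
  congr 1
  ext x
  by_cases hx : x ∈ Set.Ici (0 : ℝ) <;> simp [Set.indicator, hx]

theorem nonnegProj_posSemidef {A : Matrix ι ι ℂ} (hA : A.IsHermitian) :
    (nonnegProj A).PosSemidef :=
  posSemidef_of_idempotent (isHermitian_cfc _ _) (nonnegProj_mul_self hA)

theorem one_sub_nonnegProj_posSemidef {A : Matrix ι ι ℂ} (hA : A.IsHermitian) :
    (1 - nonnegProj A).PosSemidef := by
  refine posSemidef_of_idempotent (isHermitian_one.sub (isHermitian_cfc _ _)) ?_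
  rw [Matrix.mul_sub, Matrix.sub_mul, Matrix.sub_mul, nonnegProj_mul_self hA]
  simp

theorem exists_posPart_negPart {A : Matrix ι ι ℂ} (hA : A.IsHermitian) :
    ∃ P N : Matrix ι ι ℂ, P.PosSemidef ∧ N.PosSemidef ∧ A = P - N ∧ nonnegProj A * A = P := by
  have hc := continuousOn_spectrum hA
  have hsq : ∀ f g : ℝ → ℝ, (∀ x, f x * f x = g x) → (cfc g A).PosSemidef := by
    intro f g hfg
    have : cfc g A = cfc f A * cfc f A := by
      rw [← cfc_mul _ _ A (hc _) (hc _)]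
      congr 1
      ext x
      exact (hfg x).symm
    rw [this]
    exact posSemidef_mul_self (isHermitian_cfc _ _)
  have hid : cfc (fun x : ℝ => x) A = A := cfc_id' ℝ A hA
  refine ⟨cfc (fun x => max x 0) A, cfc (fun x => max (-x) 0) A,
    hsq (fun x => √(max x 0)) _ fun x => Real.mul_self_sqrt (le_max_right _ _),
    hsq (fun x => √(max (-x) 0)) _ fun x => Real.mul_self_sqrt (le_max_right _ _), ?_, ?_⟩
  · rw [← cfc_sub _ _ A (hc _) (hc _)]
    conv_lhs => rw [← hid]
    congr 1
    ext x
    rcases le_total x 0 with h | h <;> simp [h]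
  · rw [nonnegProj]
    nth_rewrite 2 [← hid]
    rw [← cfc_mul _ _ A (hc _) (hc _)]
    congr 1
    ext x
    by_cases h : 0 ≤ x
    · simp [Set.indicator, h]
    · simp [Set.indicator, h, (not_le.mp h).le]

theorem nonnegProj_trace_nonneg {A : Matrix ι ι ℂ} (hA : A.IsHermitian) :
    0 ≤ (trace (nonnegProj A * A)).re := by
  obtain ⟨P, N, hP, -, -, h⟩ := exists_posPart_negPart hA
  rw [h]
  exact (Complex.nonneg_iff.mp hP.trace_nonneg).1

/-- Neyman–Pearson optimality: with A = P - N, Tr TA ≤ Tr TP ≤ Tr P. -/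
theorem trace_le_nonnegProj_trace {A T : Matrix ι ι ℂ} (hA : A.IsHermitian) (hT : T.PosSemidef)
    (hT1 : (1 - T).PosSemidef) : (trace (T * A)).re ≤ (trace (nonnegProj A * A)).re := by
  obtain ⟨P, N, hP, hN, hPN, h⟩ := exists_posPart_negPart hA
  rw [h]
  have h1 := trace_mul_re_nonneg hT hN
  have h2 := trace_mul_re_mono hT1 hP
  rw [Matrix.one_mul] at h2
  conv_lhs => rw [hPN, Matrix.mul_sub, trace_sub, Complex.sub_re]
  linarith

end Measurement


/-! ### Expectations over random codebooks -/

section Codebook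

variable {ι U : Type*} [Fintype ι] [DecidableEq ι] [Fintype U]

/-- Expectation of `F` over a codebook whose entries are drawn independently from `w`. -/
noncomputable def iidExp (w : U → ℝ) (F : (ι → U) → ℝ) : ℝ := ∑ ω : ι → U, (∏ i, w (ω i)) * F ω

theorem iidExp_add (w : U → ℝ) (F G : (ι → U) → ℝ) :
    iidExp w (fun ω => F ω + G ω) = iidExp w F + iidExp w G := by
  simp [iidExp, mul_add, Finset.sum_add_distrib]

theorem iidExp_mul_left (w : U → ℝ) (c : ℝ) (F : (ι → U) → ℝ) :
    iidExp w (fun ω => c * F ω) = c * iidExp w F := by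
  simp only [iidExp, Finset.mul_sum]
  exact Finset.sum_congr rfl fun _ _ => by ring

theorem iidExp_sum {κ : Type*} (s : Finset κ) (w : U → ℝ) (F : κ → (ι → U) → ℝ) :
    iidExp w (fun ω => ∑ k ∈ s, F k ω) = ∑ k ∈ s, iidExp w (F k) := by
  simp only [iidExp, Finset.mul_sum]
  exact Finset.sum_comm

theorem iidExp_prod (w : U → ℝ) (g : ι → U → ℝ) :
    iidExp w (fun ω => ∏ i, g i (ω i)) = ∏ i, ∑ u, w u * g i u := by
  simp only [iidExp, ← Finset.prod_mul_distrib]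
  exact (Fintype.prod_sum fun i u => w u * g i u).symm

variable {w : U → ℝ}

theorem iidExp_const (hw : ∑ u, w u = 1) (c : ℝ) : iidExp (ι := ι) w (fun _ => c) = c := by
  have h := iidExp_prod (ι := ι) w (fun _ _ => 1)
  have h' := iidExp_mul_left (ι := ι) w c (fun _ => 1)
  simp only [Finset.prod_const_one, mul_one, hw] at h h'
  rw [h', h, mul_one]

theorem iidExp_prod_subset (hw : ∑ u, w u = 1) (s : Finset ι) (g : ι → U → ℝ) :
    iidExp w (fun ω => ∏ i ∈ s, g i (ω i)) = ∏ i ∈ s, ∑ u, w u * g i u := by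
  have h := iidExp_prod w (fun i u => if i ∈ s then g i u else 1)
  simp only [Finset.prod_ite_mem, Finset.univ_inter] at h
  rw [h, ← Finset.prod_subset (Finset.subset_univ s)]
  · exact Finset.prod_congr rfl fun i hi => by simp [hi]
  · intro i _ hi
    simp [hi, hw]

theorem iidExp_eval (hw : ∑ u, w u = 1) (i : ι) (f : U → ℝ) :
    iidExp w (fun ω => f (ω i)) = ∑ u, w u * f u := by
  have := iidExp_prod_subset hw {i} (fun _ => f)
  simpa using this

theorem iidExp_eval_two [DecidableEq U] (hw : ∑ u, w u = 1) {i j : ι} (hij : i ≠ j)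
    (f : U → U → ℝ) :
    iidExp w (fun ω => f (ω i) (ω j)) = ∑ u, ∑ v, w u * w v * f u v := by
  -- Fixing the value v of the second entry by an indicator turns f into a sum of products, to which
  -- independence applies.
  have h : ∀ ω : ι → U, f (ω i) (ω j) = ∑ v, ∏ k ∈ {i, j},
      (fun k u => if k = i then f u v else if u = v then 1 else 0) k (ω k) := by
    intro ω
    simp [Finset.prod_pair hij, hij.symm]
  simp only [h]
  rw [iidExp_sum, Finset.sum_comm]
  refine Finset.sum_congr rfl fun v _ => ?_
  have h2 := iidExp_prod_subset hw {i, j}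
    (fun k u => if k = i then f u v else if u = v then 1 else 0)
  rw [Finset.prod_pair hij] at h2
  rw [h2]
  simp only [if_true, hij.symm, if_false, mul_ite, mul_one, mul_zero, Finset.sum_ite_eq',
    Finset.mem_univ, Finset.sum_mul]
  exact Finset.sum_congr rfl fun u _ => by ring

/-- Derandomization: some codebook is no worse than the average. -/
theorem exists_le_iidExp (hw : ∀ u, 0 ≤ w u) (hw1 : ∑ u, w u = 1) (F : (ι → U) → ℝ) :
    ∃ ω, F ω ≤ iidExp w F := by
  by_contra! h
  have hne : ∃ ω : ι → U, 0 < ∏ i, w (ω i) := by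
    obtain ⟨u, hu⟩ : ∃ u, 0 < w u := by
      by_contra! h0
      have : ∑ u, w u ≤ 0 := Finset.sum_nonpos fun u _ => h0 u
      linarith
    exact ⟨fun _ => u, Finset.prod_pos fun _ _ => hu⟩
  obtain ⟨ω₀, hω₀⟩ := hne
  have hlt : iidExp w (fun _ : ι → U => iidExp w F) < iidExp w F :=
    Finset.sum_lt_sum
      (fun ω _ => mul_le_mul_of_nonneg_left (h ω).le (Finset.prod_nonneg fun _ _ => hw _))
      ⟨ω₀, Finset.mem_univ _, mul_lt_mul_of_pos_left (h ω₀) hω₀⟩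
  rw [iidExp_const hw1] at hlt
  exact lt_irrefl _ hlt

end Codebook

/-! ### Selection of a codeword -/

section Selection

theorem one_le_sum_add_prod_one_sub {J : Type*} (s : Finset J) (a : J → ℝ) (h0 : ∀ j, 0 ≤ a j)
    (h1 : ∀ j, a j ≤ 1) : 1 ≤ ∑ j ∈ s, a j + ∏ j ∈ s, (1 - a j) := by
  classical
  induction s using Finset.induction_on with
  | empty => simp
  | insert j s hj ih =>
    rw [Finset.sum_insert hj, Finset.prod_insert hj]
    have hp : ∏ j ∈ s, (1 - a j) ≤ 1 :=
      Finset.prod_le_one (fun j _ => by linarith [h1 j]) fun j _ => by linarith [h0 j]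
    nlinarith [h0 j]

/-- Some cost is at most the cost paid when each `j` is accepted with probability `a j` and the
cost is `b` if none is accepted. -/
theorem exists_le_sum_mul_add_prod {J : Type*} [Fintype J] [Nonempty J] (a c : J → ℝ) (b : ℝ)
    (h0 : ∀ j, 0 ≤ a j) (h1 : ∀ j, a j ≤ 1) (hc0 : ∀ j, 0 ≤ c j) (hcb : ∀ j, c j ≤ b) :
    ∃ j, c j ≤ ∑ j, a j * c j + b * ∏ j, (1 - a j) := by
  obtain ⟨j₀, hj₀⟩ := Finite.exists_min c
  refine ⟨j₀, ?_⟩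
  have h := mul_le_mul_of_nonneg_left (one_le_sum_add_prod_one_sub Finset.univ a h0 h1) (hc0 j₀)
  have hs : c j₀ * ∑ j, a j ≤ ∑ j, a j * c j := by
    rw [Finset.mul_sum]
    exact Finset.sum_le_sum fun j _ => by
      rw [mul_comm]; exact mul_le_mul_of_nonneg_left (hj₀ j) (h0 j)
  have hp : c j₀ * ∏ j, (1 - a j) ≤ b * ∏ j, (1 - a j) :=
    mul_le_mul_of_nonneg_right (hcb j₀) (Finset.prod_nonneg fun j _ => by linarith [h1 j])
  linarith

variable {Y : Type*} {q v : Y → ℝ} {K : ℝ}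

open Classical in
/-- Acceptance probability with which rejection sampling from `q` produces, up to the factor `K`,
the part of `v` that is bounded by `K • q`. -/
noncomputable def acceptProb (q v : Y → ℝ) (K : ℝ) (y : Y) : ℝ :=
  if v y ≤ K * q y then v y / (K * q y) else 0

theorem acceptProb_nonneg (hq : ∀ y, 0 ≤ q y) (hv : ∀ y, 0 ≤ v y) (hK : 0 < K) (y : Y) :
    0 ≤ acceptProb q v K y := by
  unfold acceptProb
  split_ifs
  · exact div_nonneg (hv y) (mul_nonneg hK.le (hq y))
  · exact le_rfl

theorem acceptProb_le_one (hq : ∀ y, 0 ≤ q y) (hK : 0 < K) (y : Y) : acceptProb q v K y ≤ 1 := by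
  unfold acceptProb
  split_ifs with h
  · exact div_le_one_of_le₀ h (mul_nonneg hK.le (hq y))
  · exact zero_le_one

/-- Accepted samples have density at most v/K. This transfers any nonnegative cost under v to the
codebook. -/
theorem mul_acceptProb_le (hq : ∀ y, 0 ≤ q y) (hv : ∀ y, 0 ≤ v y) (hK : 0 < K) (y : Y) :
    q y * acceptProb q v K y ≤ v y / K := by
  unfold acceptProb
  split_ifs with h
  · rcases (hq y).eq_or_lt with h0 | h0
    · rw [← h0, zero_mul]; exact div_nonneg (hv y) hK.le
    · exact le_of_eq (by field_simp)
  · rw [mul_zero]; exact div_nonneg (hv y) hK.le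

variable [Fintype Y]

open Classical in
/-- The mass that `v` puts where it exceeds `K • q`. -/
noncomputable def excessMass (q v : Y → ℝ) (K : ℝ) : ℝ := ∑ y, if K * q y < v y then v y else 0

/-- The success probability of one trial: the part of v below K q survives, scaled by 1/K. -/
theorem sum_mul_acceptProb (hq : ∀ y, 0 ≤ q y) (hv : ∀ y, 0 ≤ v y) (hv1 : ∑ y, v y = 1)
    (hK : 0 < K) : ∑ y, q y * acceptProb q v K y = (1 - excessMass q v K) / K := by
  rw [← hv1, excessMass, ← Finset.sum_sub_distrib, Finset.sum_div]
  refine Finset.sum_congr rfl fun y _ => ?_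
  unfold acceptProb
  by_cases h : v y ≤ K * q y
  · rw [if_pos h, if_neg (not_lt.mpr h), sub_zero]
    rcases (hq y).eq_or_lt with h0 | h0
    · rw [← h0, mul_zero] at h
      rw [← h0, le_antisymm h (hv y)]; simp
    · field_simp
  · rw [if_neg h, if_pos (not_le.mp h)]; simp

theorem excessMass_nonneg (hv : ∀ y, 0 ≤ v y) : 0 ≤ excessMass q v K :=
  Finset.sum_nonneg fun y _ => by split_ifs; exacts [hv y, le_rfl]

theorem excessMass_le_one (hv : ∀ y, 0 ≤ v y) (hv1 : ∑ y, v y = 1) : excessMass q v K ≤ 1 := by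
  rw [← hv1]
  exact Finset.sum_le_sum fun y _ => by split_ifs; exacts [le_rfl, hv y]

/-- The probability that none of `J` samples is accepted. -/
theorem one_sub_div_pow_le {e L K : ℝ} (he0 : 0 ≤ e) (he1 : e ≤ 1) (hK : 0 < K)
    (h0 : 0 ≤ 1 - (1 - e) / K) {J : ℕ} (hJ : L * K ≤ J) :
    (1 - (1 - e) / K) ^ J ≤ e + Real.exp (-L) := by
  have h1 : (1 - (1 - e) / K) ^ J ≤ Real.exp (-(L * (1 - e))) := by
    refine (pow_le_pow_left₀ h0 (Real.one_sub_le_exp_neg _) J).trans ?_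
    rw [← Real.exp_nat_mul, Real.exp_le_exp]
    have : L * (1 - e) = L * K * ((1 - e) / K) := by field_simp
    rw [this, mul_neg, neg_le_neg_iff]
    exact mul_le_mul_of_nonneg_right hJ (div_nonneg (by linarith) hK.le)
  refine h1.trans ?_
  -- Convexity of exp between 0 and -L: exp(-L(1 - e)) ≤ e + (1 - e)exp(-L).
  have h2 := convexOn_exp.2 (Set.mem_univ (0 : ℝ)) (Set.mem_univ (-L)) he0
    (sub_nonneg.mpr he1) (by ring)
  simp only [smul_eq_mul, mul_zero, zero_add, Real.exp_zero, mul_one] at h2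
  rw [show -(L * (1 - e)) = (1 - e) * -L by ring]
  refine h2.trans ?_
  nlinarith [Real.exp_pos (-L)]

end Selection


/-! ### One-shot covering and packing by rejection sampling. -/

section OneShot

/-- Covering: a random codebook of `t`s from which an encoder that sees `s` can select with a cost
comparable to the cost under the kernel `V`. -/
theorem exists_covering_codebook {S T : Type*} [Fintype S] [Fintype T] {p : S → ℝ}
    (hp : ∀ s, 0 ≤ p s) {V : S → T → ℝ} (hV : ∀ s, V s ∈ stdSimplex ℝ T) {q : T → ℝ}
    (hq : q ∈ stdSimplex ℝ T) {K : ℝ} (hK : 0 < K) (n : ℕ) (hn : 0 < n) (h : S → T → ℝ)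
    (h0 : ∀ s t, 0 ≤ h s t) (h1 : ∀ s t, h s t ≤ 1) :
    ∃ (τ : Fin n → T) (f : S → Fin n), ∑ s, p s * h s (τ (f s)) ≤
      n / K * (∑ s, p s * ∑ t, V s t * h s t) +
        ∑ s, p s * (1 - (1 - excessMass q (V s) K) / K) ^ n := by
  have : Nonempty (Fin n) := ⟨⟨0, hn⟩⟩
  -- The averaged quantity charges 1 when every sample is rejected. The encoder then takes an index
  -- whose cost is no larger.
  obtain ⟨τ, hτ⟩ := exists_le_iidExp (ι := Fin n) hq.1 hq.2 fun τ => ∑ s, p s *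
    (∑ k, acceptProb q (V s) K (τ k) * h s (τ k) + 1 * ∏ k, (1 - acceptProb q (V s) K (τ k)))
  have hsel := fun s => exists_le_sum_mul_add_prod (fun k => acceptProb q (V s) K (τ k))
    (fun k => h s (τ k)) 1 (fun k => acceptProb_nonneg hq.1 (hV s).1 hK _)
    (fun k => acceptProb_le_one hq.1 hK _) (fun k => h0 _ _) (fun k => h1 _ _)
  choose f hf using hsel
  refine ⟨τ, f, (Finset.sum_le_sum fun s _ => mul_le_mul_of_nonneg_left (hf s) (hp s)).trans
    (hτ.trans ?_)⟩
  rw [iidExp_sum, Finset.mul_sum, ← Finset.sum_add_distrib]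
  refine Finset.sum_le_sum fun s _ => ?_
  rw [iidExp_mul_left, iidExp_add, iidExp_sum, iidExp_mul_left, one_mul,
    iidExp_prod q (fun _ t => 1 - acceptProb q (V s) K t)]
  simp only [iidExp_eval hq.2 _ fun t => acceptProb q (V s) K t * h s t]
  simp only [mul_sub, mul_one, Finset.sum_sub_distrib, hq.2,
    sum_mul_acceptProb hq.1 (hV s).1 (hV s).2 hK]
  simp only [Finset.prod_const, Finset.sum_const, Finset.card_univ, Fintype.card_fin, nsmul_eq_mul]
  rw [mul_add]
  refine add_le_add_left ?_ _
  rw [mul_left_comm ((n : ℝ) / K)]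
  refine mul_le_mul_of_nonneg_left ?_ (hp s)
  rw [div_mul_eq_mul_div, mul_div_assoc, Finset.sum_div]
  refine mul_le_mul_of_nonneg_left (Finset.sum_le_sum fun t _ => ?_) (Nat.cast_nonneg n)
  rw [← mul_assoc, mul_div_right_comm]
  exact mul_le_mul_of_nonneg_right (mul_acceptProb_le hq.1 (hV s).1 hK t) (h0 s t)

/-- Packing: a random codebook of `u`s, a decoder for it, and an encoder that selects one of the
codewords of a message depending on `t`. -/
theorem exists_packing_codebook {T U D : Type*} [Fintype T] [Fintype U] [DecidableEq U] [Fintype D]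
    [DecidableEq D] {V : T → U → ℝ} (hV : ∀ t, V t ∈ stdSimplex ℝ U) {q : U → ℝ}
    (hq : q ∈ stdSimplex ℝ U) {K : ℝ} (hK : 0 < K) {σ : T → U → Matrix D D ℂ}
    (hσ : ∀ t u, (σ t u).PosSemidef) {w : T → ℝ} (hw : ∀ t u, (σ t u).trace.re = w t)
    {Λ : U → Matrix D D ℂ} (h0 : ∀ u, (Λ u).PosSemidef) (h1 : ∀ u, (1 - Λ u).PosSemidef)
    {δ : ℝ} (hδ : 0 < δ) (M J : ℕ) (hM : 0 < M) (hJ : 0 < J) :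
    ∃ (ω : Fin M × Fin J → U) (β : Fin M → Matrix D D ℂ) (j : Fin M → T → Fin J),
      (∀ m, (β m).PosSemidef) ∧ ∑ m, β m = 1 ∧
      1 / (M : ℝ) * ∑ m, ∑ t, (trace ((1 - β m) * σ t (ω (m, j m t)))).re ≤
        J / K * (2 * ∑ t, ∑ u, V t u * (trace ((1 - Λ u) * σ t u)).re +
          4 * (M * J * ∑ t, ∑ u, V t u * ∑ v, q v * (trace (Λ v * σ t u)).re + δ * ∑ t, w t)) +
        ∑ t, w t * (1 - (1 - excessMass q (V t) K) / K) ^ J := by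
  have : Nonempty (Fin J) := ⟨⟨0, hJ⟩⟩
  have : Nonempty (Fin M) := ⟨⟨0, hM⟩⟩
  have hMpos : (0 : ℝ) < M := Nat.cast_pos.mpr hM
  set a : T → U → ℝ := fun t => acceptProb q (V t) K with ha
  -- The Hayashi–Nagaoka bound splits into `g`, which sees only the transmitted codeword, and `c`,
  -- which pairs it with one competitor.
  set g : T → U → ℝ := fun t u => 2 * (trace ((1 - Λ u) * σ t u)).re + 4 * (δ * w t) with hg
  set c : T → U → U → ℝ := fun t u v => 4 * (trace (Λ v * σ t u)).re with hc
  have ha0 : ∀ t u, 0 ≤ a t u := fun t u => acceptProb_nonneg hq.1 (hV t).1 hK u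
  have ha1 : ∀ t u, a t u ≤ 1 := fun t u => acceptProb_le_one hq.1 hK u
  have hw0 : ∀ t u, 0 ≤ w t := fun t u => by
    rw [← hw t u]; exact (Complex.nonneg_iff.mp (hσ t u).trace_nonneg).1
  have hg0 : ∀ t u, 0 ≤ g t u := fun t u => by
    have := trace_mul_re_nonneg (h1 u) (hσ t u)
    have := mul_nonneg hδ.le (hw0 t u)
    simp only [hg]; linarith
  have hc0 : ∀ t u v, 0 ≤ c t u v := fun t u v => by
    have := trace_mul_re_nonneg (h0 v) (hσ t u)
    simp only [hc]; linarith
  set F : Fin M → T → (Fin M × Fin J → U) → ℝ := fun m t ω =>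
    ∑ j, (a t (ω (m, j)) * g t (ω (m, j)) +
      ∑ i ∈ Finset.univ.erase (m, j), a t (ω (m, j)) * c t (ω (m, j)) (ω i)) +
    w t * ∏ j, (1 - a t (ω (m, j))) with hF
  obtain ⟨ω, hω⟩ := exists_le_iidExp hq.1 hq.2 fun ω => 1 / (M : ℝ) * ∑ m, ∑ t, F m t ω
  obtain ⟨β, hβ, hβ1, hβΛ⟩ := exists_povm_of_tests (⟨0, hM⟩ : Fin M) (fun i => Λ (ω i))
    (fun i => h0 _) (fun i => h1 _) hδ
  have hβle : ∀ m, (1 - β m).PosSemidef := fun m => by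
    rw [← hβ1, ← Finset.add_sum_erase _ _ (Finset.mem_univ m), add_sub_cancel_left]
    exact posSemidef_sum _ fun i _ => hβ i
  -- The fallback cost is w t, the full trace of the state, which does not depend on the codeword.
  have hsel : ∀ m t, ∃ j, (trace ((1 - β m) * σ t (ω (m, j)))).re ≤ F m t ω := by
    intro m t
    obtain ⟨j, hj⟩ := exists_le_sum_mul_add_prod (fun j => a t (ω (m, j)))
      (fun j => (trace ((1 - β m) * σ t (ω (m, j)))).re) (w t) (fun j => ha0 _ _)
      (fun j => ha1 _ _) (fun j => trace_mul_re_nonneg (hβle m) (hσ _ _)) (fun j => by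
        rw [← hw t (ω (m, j)), Matrix.sub_mul, trace_sub, Complex.sub_re, Matrix.one_mul]
        linarith [trace_mul_re_nonneg (hβ m) (hσ t (ω (m, j)))])
    refine ⟨j, hj.trans ?_⟩
    simp only [hF]
    gcongr with j _
    rw [← Finset.mul_sum, ← mul_add]
    refine mul_le_mul_of_nonneg_left ((hβΛ m j _ (hσ _ _)).trans_eq ?_) (ha0 _ _)
    simp only [hg, hc, hw, ← Finset.mul_sum]
    ring
  choose j hj using hsel
  refine ⟨ω, β, j, hβ, hβ1, ?_⟩
  calc 1 / (M : ℝ) * ∑ m, ∑ t, (trace ((1 - β m) * σ t (ω (m, j m t)))).re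
      ≤ 1 / (M : ℝ) * ∑ m, ∑ t, F m t ω := by
        gcongr with m _ t _
        exact hj m t
    _ ≤ 1 / (M : ℝ) * ∑ m, ∑ t, iidExp q (F m t) := by
        refine hω.trans_eq ?_
        rw [iidExp_mul_left, iidExp_sum]
        simp only [iidExp_sum]
    _ ≤ 1 / (M : ℝ) * ∑ m : Fin M, ∑ t, (J / K * (∑ u, V t u * g t u +
          M * J * ∑ u, V t u * ∑ v, q v * c t u v) +
          w t * (1 - (1 - excessMass q (V t) K) / K) ^ J) := by
        gcongr with m _ t _
        simp only [hF]
        rw [iidExp_add, iidExp_sum, iidExp_mul_left]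
        refine add_le_add ?_ (le_of_eq ?_)
        · have hterm : ∀ j : Fin J, iidExp q (fun ω => a t (ω (m, j)) * g t (ω (m, j)) +
              ∑ i ∈ Finset.univ.erase (m, j), a t (ω (m, j)) * c t (ω (m, j)) (ω i)) ≤
              1 / K * (∑ u, V t u * g t u + M * J * ∑ u, V t u * ∑ v, q v * c t u v) := by
            intro j
            rw [iidExp_add, iidExp_sum, iidExp_eval hq.2 _ fun u => a t u * g t u, mul_add]
            refine add_le_add ?_ ?_
            · rw [Finset.mul_sum]
              refine Finset.sum_le_sum fun u _ => ?_
              rw [← mul_assoc, ← mul_assoc, one_div_mul_eq_div]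
              exact mul_le_mul_of_nonneg_right (mul_acceptProb_le hq.1 (hV t).1 hK u) (hg0 t u)
            -- Acceptance of an entry depends on that entry alone, so every competitor remains an
            -- independent draw from q.
            · have hpair : ∀ i ∈ Finset.univ.erase (m, j),
                  iidExp q (fun ω => a t (ω (m, j)) * c t (ω (m, j)) (ω i)) ≤
                    1 / K * ∑ u, V t u * ∑ v, q v * c t u v := by
                intro i hi
                rw [iidExp_eval_two hq.2 (Finset.ne_of_mem_erase hi).symm
                  fun u v => a t u * c t u v, Finset.mul_sum]
                refine Finset.sum_le_sum fun u _ => ?_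
                have : ∑ v, q u * q v * (a t u * c t u v) =
                    (q u * a t u) * ∑ v, q v * c t u v := by
                  rw [Finset.mul_sum]
                  exact Finset.sum_congr rfl fun v _ => by ring
                rw [this, ← mul_assoc, one_div_mul_eq_div]
                exact mul_le_mul_of_nonneg_right (mul_acceptProb_le hq.1 (hV t).1 hK u)
                  (Finset.sum_nonneg fun v _ => mul_nonneg (hq.1 v) (hc0 t u v))
              refine (Finset.sum_le_card_nsmul _ _ _ hpair).trans ?_
              have hX : 0 ≤ 1 / K * ∑ u, V t u * ∑ v, q v * c t u v :=
                mul_nonneg (by positivity) (Finset.sum_nonneg fun u _ => mul_nonneg ((hV t).1 u)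
                  (Finset.sum_nonneg fun v _ => mul_nonneg (hq.1 v) (hc0 t u v)))
              rw [nsmul_eq_mul, mul_left_comm (1 / K)]
              refine mul_le_mul_of_nonneg_right ?_ hX
              have : (Finset.univ.erase (m, j)).card ≤ M * J :=
                (Finset.card_erase_le).trans (by simp)
              exact_mod_cast this
          refine (Finset.sum_le_card_nsmul _ _ _ fun j _ => hterm j).trans_eq ?_
          rw [Finset.card_univ, Fintype.card_fin, nsmul_eq_mul]
          ring
        -- The rejection event involves just the J entries belonging to message m.
        · have := iidExp_prod_subset hq.2
            (Finset.univ.map ⟨fun j : Fin J => (m, j), fun _ _ h => (Prod.mk.inj h).2⟩)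
            fun _ u => 1 - a t u
          rw [Finset.prod_const, Finset.card_map, Finset.card_univ, Fintype.card_fin] at this
          simp only [Finset.prod_map] at this
          rw [show iidExp q (fun ω => ∏ j, (1 - a t (ω (m, j)))) = _ from this]
          simp only [ha, mul_sub, mul_one, Finset.sum_sub_distrib, hq.2,
            sum_mul_acceptProb hq.1 (hV t).1 (hV t).2 hK]
    _ = _ := by
        rw [Finset.sum_const, Finset.card_univ, Fintype.card_fin, nsmul_eq_mul, ← mul_assoc,
          one_div_mul_cancel hMpos.ne', one_mul, Finset.sum_add_distrib, ← Finset.mul_sum]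
        congr 2
        have e1 : ∀ t, ∑ u, V t u * g t u =
            2 * ∑ u, V t u * (trace ((1 - Λ u) * σ t u)).re + 4 * (δ * w t) := by
          intro t
          simp only [hg, mul_add, Finset.sum_add_distrib, ← Finset.sum_mul, (hV t).2, one_mul]
          rw [Finset.mul_sum]
          congr 1
          exact Finset.sum_congr rfl fun u _ => by ring
        have e2 : ∀ t, ∑ u, V t u * ∑ v, q v * c t u v =
            4 * ∑ u, V t u * ∑ v, q v * (trace (Λ v * σ t u)).re := by
          intro t
          simp only [hc, Finset.mul_sum]
          exact Finset.sum_congr rfl fun u _ => Finset.sum_congr rfl fun v _ => by ring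
        simp only [e1, e2, Finset.sum_add_distrib, ← Finset.mul_sum]
        ring

end OneShot


noncomputable section

/-! ### Block-diagonal (classical-quantum) matrices -/

section CQMatrix

variable {U D : Type*} [Fintype U] [DecidableEq U]

/-- The classical-quantum matrix `∑ u, |u⟩⟨u| ⊗ Q u`. -/
def cqMatrix (Q : U → Matrix D D ℂ) : Matrix (U × D) (U × D) ℂ :=
  ∑ u, single u u (1 : ℂ) ⊗ₖ Q u

theorem cqMatrix_apply (Q : U → Matrix D D ℂ) (i j : U × D) :
    cqMatrix Q i j = if i.1 = j.1 then Q i.1 i.2 j.2 else 0 := by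
  simp only [cqMatrix, Matrix.sum_apply, kroneckerMap_apply, single_apply, ite_mul, one_mul,
    zero_mul, ite_and, Finset.sum_ite_eq', Finset.mem_univ, if_true]

theorem cqMatrix_sub (Q Q' : U → Matrix D D ℂ) :
    cqMatrix (fun u => Q u - Q' u) = cqMatrix Q - cqMatrix Q' := by
  ext i j
  simp only [Matrix.sub_apply, cqMatrix_apply]
  split_ifs <;> simp

theorem cqMatrix_one [DecidableEq D] : cqMatrix (fun _ : U => (1 : Matrix D D ℂ)) = 1 := by
  ext ⟨u, d⟩ ⟨u', d'⟩
  simp only [cqMatrix_apply, Matrix.one_apply, Prod.mk.injEq, ite_and]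

theorem cqMatrix_submatrix (Q : U → Matrix D D ℂ) (u : U) :
    (cqMatrix Q).submatrix (Prod.mk u) (Prod.mk u) = Q u := by
  ext d d'
  simp [cqMatrix_apply]

variable [Fintype D]

theorem cqMatrix_posSemidef {Q : U → Matrix D D ℂ} (hQ : ∀ u, (Q u).PosSemidef) :
    (cqMatrix Q).PosSemidef := by
  refine posSemidef_sum _ fun u _ => PosSemidef.kronecker ?_ (hQ u)
  rw [← diagonal_single]
  refine PosSemidef.diagonal fun v => ?_
  by_cases h : v = u
  · subst h; simp
  · simp [h]

theorem trace_mul_cqMatrix (P : Matrix (U × D) (U × D) ℂ) (Q : U → Matrix D D ℂ) :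
    trace (P * cqMatrix Q) = ∑ u, trace (P.submatrix (Prod.mk u) (Prod.mk u) * Q u) := by
  simp only [trace, Matrix.diag_apply, Matrix.mul_apply, cqMatrix_apply, Fintype.sum_prod_type,
    submatrix_apply]
  refine Finset.sum_congr rfl fun u _ => Finset.sum_congr rfl fun d _ => ?_
  rw [Finset.sum_eq_single u]
  · simp
  · intro v _ hv
    simp [hv]
  · simp

end CQMatrix

set_option linter.unusedSectionVars false

/-! ### Marginals of the states of Markov form -/

variable {X S B : Type*} [Fintype X] [DecidableEq X] [Fintype S] [DecidableEq S]
  [Fintype B] [DecidableEq B]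

namespace AuxKernels

variable {T U : Type*} [Fintype T] [DecidableEq T] [Fintype U] [DecidableEq U] {n : ℕ}

/-- Distribution of `S̃^n`. -/
def distT (N : ChannelSeq X S B) (P : AuxKernels X S T U n) (t : T) : ℝ :=
  ∑ s, N.stateDist n s * P.pT s t

/-- Distribution of `U^n`. -/
def distU (N : ChannelSeq X S B) (P : AuxKernels X S T U n) (u : U) : ℝ :=
  ∑ t, P.distT N t * P.pU t u

/-- Output state averaged over the input distribution `p(x | u, s̃)`. -/
def outAvg (N : ChannelSeq X S B) (P : AuxKernels X S T U n) (s : Fin n → S) (t : T) (u : U) :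
    Matrix (Fin n → B) (Fin n → B) ℂ :=
  ∑ x, P.pX u t x • N.out x s

/-- Output state given `s̃` and `u`, weighted by the probability of `s̃`. -/
def outTU (N : ChannelSeq X S B) (P : AuxKernels X S T U n) (t : T) (u : U) :
    Matrix (Fin n → B) (Fin n → B) ℂ :=
  ∑ s, (N.stateDist n s * P.pT s t) • P.outAvg N s t u

/-- Output state given `u`, weighted by the probability of `u`. -/
def outU (N : ChannelSeq X S B) (P : AuxKernels X S T U n) (u : U) :
    Matrix (Fin n → B) (Fin n → B) ℂ :=
  ∑ t, P.pU t u • P.outTU N t u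

variable (N : ChannelSeq X S B) (P : AuxKernels X S T U n)

theorem jointST_eq (s : Fin n → S) (t : T) : P.jointST N s t = N.stateDist n s * P.pT s t := by
  simp only [jointST, joint, ← Finset.mul_sum, (P.pX_mem _ _).2, (P.pU_mem _).2, mul_one]

theorem jointUT_eq (u : U) (t : T) : P.jointUT N u t = P.distT N t * P.pU t u := by
  simp only [jointUT, joint, ← Finset.mul_sum, (P.pX_mem _ _).2, mul_one, ← Finset.sum_mul, distT]

theorem distT_mem : P.distT N ∈ stdSimplex ℝ T := by
  refine ⟨fun t => Finset.sum_nonneg fun s _ =>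
    mul_nonneg ((N.stateDist_mem n).1 s) ((P.pT_mem s).1 t), ?_⟩
  simp only [distT]
  rw [Finset.sum_comm]
  simp only [← Finset.mul_sum, (P.pT_mem _).2, mul_one, (N.stateDist_mem n).2]

theorem distU_mem : P.distU N ∈ stdSimplex ℝ U := by
  refine ⟨fun t => Finset.sum_nonneg fun s _ =>
    mul_nonneg ((P.distT_mem N).1 s) ((P.pU_mem s).1 t), ?_⟩
  simp only [distU]
  rw [Finset.sum_comm]
  simp only [← Finset.mul_sum, (P.pU_mem _).2, mul_one, (P.distT_mem N).2]

theorem marginalFst_jointST (s : Fin n → S) :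
    marginalFst (P.jointST N) s = N.stateDist n s := by
  simp only [marginalFst, jointST_eq, ← Finset.mul_sum, (P.pT_mem _).2, mul_one]

theorem marginalSnd_jointST (t : T) : marginalSnd (P.jointST N) t = P.distT N t := by
  simp only [marginalSnd, jointST_eq, distT]

theorem marginalFst_jointUT (u : U) : marginalFst (P.jointUT N) u = P.distU N u := by
  simp only [marginalFst, jointUT_eq, distU]

theorem marginalSnd_jointUT (t : T) : marginalSnd (P.jointUT N) t = P.distT N t := by
  simp only [marginalSnd, jointUT_eq, ← Finset.mul_sum, (P.pU_mem _).2, mul_one]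

theorem outAvg_posSemidef (s : Fin n → S) (t : T) (u : U) : (P.outAvg N s t u).PosSemidef :=
  posSemidef_sum _ fun x _ => (N.out_posSemidef x s).smul ((P.pX_mem u t).1 x)

theorem outTU_posSemidef (t : T) (u : U) : (P.outTU N t u).PosSemidef :=
  posSemidef_sum _ fun s _ => (P.outAvg_posSemidef N s t u).smul
    (mul_nonneg ((N.stateDist_mem n).1 s) ((P.pT_mem s).1 t))

theorem outU_posSemidef (u : U) : (P.outU N u).PosSemidef :=
  posSemidef_sum _ fun t _ => (P.outTU_posSemidef N t u).smul ((P.pU_mem t).1 u)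

theorem trace_outAvg (s : Fin n → S) (t : T) (u : U) : (P.outAvg N s t u).trace = 1 := by
  simp only [outAvg, trace_sum, trace_smul, N.out_trace, Complex.real_smul, mul_one]
  rw [← Complex.ofReal_sum, (P.pX_mem u t).2, Complex.ofReal_one]

theorem trace_outTU (t : T) (u : U) : (P.outTU N t u).trace = P.distT N t := by
  simp only [outTU, trace_sum, trace_smul, trace_outAvg, Complex.real_smul, mul_one]
  rw [← Complex.ofReal_sum, distT]

theorem trace_outU (u : U) : (P.outU N u).trace = P.distU N u := by
  simp only [outU, trace_sum, trace_smul, trace_outTU, Complex.real_smul]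
  rw [distU, Complex.ofReal_sum]
  exact Finset.sum_congr rfl fun t _ => by rw [Complex.ofReal_mul, mul_comm]

theorem state_apply (s : Fin n → S) (t : T) (u u' : U) (x : Fin n → X) (b b' : Fin n → B) :
    P.state N (s, t, u, x, b) (s, t, u', x, b') =
      if u = u' then (P.joint N s t u x : ℂ) * N.out x s b b' else 0 := by
  simp only [state, Matrix.sum_apply, Matrix.smul_apply, kroneckerMap_apply, single_apply,
    and_self, ite_mul, one_mul, zero_mul, smul_ite, smul_zero, ite_and,
    Complex.real_smul]
  simp

theorem stateUB_eq : P.stateUB N = cqMatrix (P.outU N) := by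
  ext i j
  rw [cqMatrix_apply]
  simp only [stateUB, of_apply, state_apply]
  split_ifs with h
  · simp only [outU, outTU, outAvg, Matrix.sum_apply, Matrix.smul_apply, Complex.real_smul, joint,
      Finset.mul_sum]
    rw [Finset.sum_comm]
    refine Finset.sum_congr rfl fun t _ => Finset.sum_congr rfl fun s _ =>
      Finset.sum_congr rfl fun x _ => ?_
    push_cast
    ring
  · simp

theorem stateU_eq : P.stateU N = diagonal fun u => (P.distU N u : ℂ) := by
  ext u u'
  simp only [stateU, of_apply, stateUB_eq, cqMatrix_apply, diagonal_apply]
  split_ifs with h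
  · rw [← trace_outU]; rfl
  · simp

theorem stateB_eq : P.stateB N = ∑ u, P.outU N u := by
  ext b b'
  simp [stateB, stateUB_eq, cqMatrix_apply, Matrix.sum_apply]

theorem stateB_posSemidef : (P.stateB N).PosSemidef := by
  rw [stateB_eq]
  exact posSemidef_sum _ fun u _ => P.outU_posSemidef N u

theorem trace_stateB : (P.stateB N).trace = 1 := by
  rw [stateB_eq, trace_sum]
  simp only [trace_outU]
  rw [← Complex.ofReal_sum, (P.distU_mem N).2, Complex.ofReal_one]

theorem stateU_kronecker_stateB :
    P.stateU N ⊗ₖ P.stateB N = cqMatrix fun u => P.distU N u • P.stateB N := by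
  ext i j
  rw [cqMatrix_apply, kroneckerMap_apply, stateU_eq, diagonal_apply]
  split_ifs <;> simp

theorem stateUB_posSemidef : (P.stateUB N).PosSemidef :=
  P.stateUB_eq N ▸ cqMatrix_posSemidef (P.outU_posSemidef N)

theorem stateU_kronecker_stateB_posSemidef : (P.stateU N ⊗ₖ P.stateB N).PosSemidef :=
  P.stateU_kronecker_stateB N ▸ cqMatrix_posSemidef fun u =>
    (P.stateB_posSemidef N).smul ((P.distU_mem N).1 u)

theorem trace_stateUB : (P.stateUB N).trace = 1 := by
  have h := trace_mul_cqMatrix 1 (P.outU N)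
  rw [← stateUB_eq, Matrix.one_mul] at h
  have h1 : ∀ u : U, (1 : Matrix (U × (Fin n → B)) (U × (Fin n → B)) ℂ).submatrix
      (Prod.mk u) (Prod.mk u) = 1 := fun u => by
    rw [← cqMatrix_one, cqMatrix_submatrix]
  simp only [h1, Matrix.one_mul, trace_outU] at h
  rw [h, ← Complex.ofReal_sum, (P.distU_mem N).2, Complex.ofReal_one]

/-- The test that compares `Θ^{UB}` with `c • Θ^U ⊗ Θ^B`. -/
def test (c : ℝ) : Matrix (U × (Fin n → B)) (U × (Fin n → B)) ℂ :=
  nonnegProj (P.stateUB N - c • (P.stateU N ⊗ₖ P.stateB N))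

theorem isHermitian_stateUB_sub (c : ℝ) :
    (P.stateUB N - c • (P.stateU N ⊗ₖ P.stateB N)).IsHermitian := by
  refine (P.stateUB_posSemidef N).isHermitian.sub ?_
  rw [IsHermitian, conjTranspose_smul, star_trivial,
    (P.stateU_kronecker_stateB_posSemidef N).isHermitian.eq]

theorem trace_test_mul_stateUB_le_one (c : ℝ) : (trace (P.test N c * P.stateUB N)).re ≤ 1 := by
  have h := trace_mul_re_mono
    (one_sub_nonnegProj_posSemidef (P.isHermitian_stateUB_sub N c)) (P.stateUB_posSemidef N)
  rwa [Matrix.one_mul, trace_stateUB, Complex.one_re] at h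

/-- Nonnegativity of Tr Π(ρ - cσ) gives c · Tr Πσ ≤ Tr Πρ ≤ 1, the false-alarm bound. -/
theorem trace_test_mul_product_le {c : ℝ} (hc : 0 < c) :
    (trace (P.test N c * (P.stateU N ⊗ₖ P.stateB N))).re ≤ 1 / c := by
  have h := nonnegProj_trace_nonneg (P.isHermitian_stateUB_sub N c)
  rw [Matrix.mul_sub, trace_sub, Matrix.mul_smul, trace_smul, Complex.sub_re, Complex.real_smul,
    Complex.re_ofReal_mul] at h
  rw [le_div_iff₀ hc]
  have := P.trace_test_mul_stateUB_le_one N c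
  unfold test at this ⊢
  linarith

/-- Any test `T` that detects `Θ^{UB}` but not `Θ^U ⊗ Θ^B` bounds the spectral projection. -/
theorem le_trace_test_mul_stateUB {c : ℝ} (hc : 0 ≤ c)
    {T' : Matrix (U × (Fin n → B)) (U × (Fin n → B)) ℂ} (hT : T'.PosSemidef)
    (hT1 : (1 - T').PosSemidef) :
    (trace (T' * P.stateUB N)).re - c * (trace (T' * (P.stateU N ⊗ₖ P.stateB N))).re ≤
      (trace (P.test N c * P.stateUB N)).re := by
  have h := trace_le_nonnegProj_trace (P.isHermitian_stateUB_sub N c) hT hT1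
  have h0 := mul_nonneg hc (trace_mul_re_nonneg
    (nonnegProj_posSemidef (P.isHermitian_stateUB_sub N c))
    (P.stateU_kronecker_stateB_posSemidef N))
  simp only [Matrix.mul_sub, trace_sub, Matrix.mul_smul, trace_smul, Complex.sub_re,
    Complex.real_smul, Complex.re_ofReal_mul] at h
  unfold test
  linarith

end AuxKernels

/-! ### One-shot code -/

theorem Code.error_eq {n : ℕ} (C : Code X S B n) (N : ChannelSeq X S B) :
    C.error N = 1 / (C.M : ℝ) * ∑ m, ∑ s, N.stateDist n s *
      (trace ((1 - C.povm m) * ∑ x, C.enc m (C.stateEnc s) x • N.out x s)).re := by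
  simp only [Code.error, Matrix.mul_sum, Matrix.mul_smul, trace_sum, trace_smul, Complex.re_sum,
    Complex.real_smul, Complex.re_ofReal_mul]

/-- Packing is done first, for all t at once, against the output averaged over s. Its error then
serves as the cost function of the covering. The encoder maps k to t = τ k, then to u = ω (m, j m
t), and draws x from p(x|u,t). -/
theorem exists_code {T U : Type*} [Fintype T] [DecidableEq T] [Fintype U] [DecidableEq U] {n : ℕ}
    (N : ChannelSeq X S B) (P : AuxKernels X S T U n) {KU KT c δ : ℝ} (hKU : 0 < KU)
    (hKT : 0 < KT) (hc : 0 < c) (hδ : 0 < δ) {M J Me : ℕ} (hM : 0 < M) (hJ : 0 < J)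
    (hMe : 0 < Me) :
    ∃ C : Code X S B n, C.M = M ∧ C.Me = Me ∧ C.error N ≤
      Me / KT * (J / KU * (2 * (1 - (trace (P.test N c * P.stateUB N)).re) +
        4 * (M * J * (1 / c) + δ)) +
        ∑ t, P.distT N t * (1 - (1 - excessMass (P.distU N) (P.pU t) KU) / KU) ^ J) +
      ∑ s, N.stateDist n s * (1 - (1 - excessMass (P.distT N) (P.pT s) KT) / KT) ^ Me := by
  have hMpos : (0 : ℝ) < M := Nat.cast_pos.mpr hM
  -- Only the diagonal blocks of the test act on classical-quantum states.
  set Λ : U → Matrix (Fin n → B) (Fin n → B) ℂ := fun u =>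
    (P.test N c).submatrix (Prod.mk u) (Prod.mk u) with hΛ
  have hherm := P.isHermitian_stateUB_sub N c
  have h0 : ∀ u, (Λ u).PosSemidef := fun u => (nonnegProj_posSemidef hherm).submatrix _
  have h1 : ∀ u, (1 - Λ u).PosSemidef := fun u => by
    have := (one_sub_nonnegProj_posSemidef hherm).submatrix (Prod.mk u)
    rwa [← cqMatrix_one, Matrix.submatrix_sub, Pi.sub_apply, Pi.sub_apply,
      cqMatrix_submatrix] at this
  obtain ⟨ω, β, j, hβ, hβ1, hpack⟩ := exists_packing_codebook P.pU_mem (P.distU_mem N) hKU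
    (P.outTU_posSemidef N) (w := P.distT N)
    (fun t u => by rw [P.trace_outTU N, Complex.ofReal_re]) h0 h1 hδ M J hM hJ
  have hβle : ∀ m, (1 - β m).PosSemidef := fun m => by
    rw [← hβ1, ← Finset.add_sum_erase _ _ (Finset.mem_univ m), add_sub_cancel_left]
    exact posSemidef_sum _ fun i _ => hβ i
  set err : Fin M → (Fin n → S) → T → ℝ := fun m s t =>
    (trace ((1 - β m) * P.outAvg N s t (ω (m, j m t)))).re with herr
  have herr0 : ∀ m s t, 0 ≤ err m s t := fun m s t =>
    trace_mul_re_nonneg (hβle m) (P.outAvg_posSemidef N _ _ _)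
  have herr1 : ∀ m s t, err m s t ≤ 1 := fun m s t => by
    simp only [herr]
    rw [Matrix.sub_mul, trace_sub, Complex.sub_re, Matrix.one_mul, P.trace_outAvg N,
      Complex.one_re]
    linarith [trace_mul_re_nonneg (hβ m) (P.outAvg_posSemidef N s t (ω (m, j m t)))]
  obtain ⟨τ, f, hcov⟩ := exists_covering_codebook (N.stateDist_mem n).1 P.pT_mem (P.distT_mem N)
    hKT Me hMe (fun s t => 1 / (M : ℝ) * ∑ m, err m s t)
    (fun s t => mul_nonneg (by positivity) (Finset.sum_nonneg fun m _ => herr0 m s t))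
    (fun s t => by
      rw [one_div, inv_mul_le_iff₀ hMpos, mul_one]
      refine (Finset.sum_le_card_nsmul _ _ _ fun m _ => herr1 m s t).trans_eq ?_
      simp)
  refine ⟨⟨M, hM, Me, hMe, f, fun m k => P.pX (ω (m, j m (τ k))) (τ k), fun m k => P.pX_mem _ _,
    β, hβ, hβ1⟩, rfl, rfl, ?_⟩
  rw [Code.error_eq]
  calc _ = ∑ s, N.stateDist n s * (1 / (M : ℝ) * ∑ m, err m s (τ (f s))) := by
        simp only [Finset.mul_sum]
        rw [Finset.sum_comm]
        exact Finset.sum_congr rfl fun s _ => Finset.sum_congr rfl fun m _ => by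
          rw [mul_left_comm, ← Matrix.mul_sum]; rfl
    _ ≤ _ := hcov
    _ ≤ _ := by
        refine add_le_add_left (mul_le_mul_of_nonneg_left ?_ (by positivity)) _
        -- Averaging over s with weights p(s)p(t|s) turns the covering cost into the error bounded
        -- by packing.
        have e1 : ∑ s, N.stateDist n s * ∑ t, P.pT s t * (1 / (M : ℝ) * ∑ m, err m s t) =
            1 / (M : ℝ) * ∑ m, ∑ t, (trace ((1 - β m) * P.outTU N t (ω (m, j m t)))).re := by
          simp only [AuxKernels.outTU, Matrix.mul_smul, trace_sum, trace_smul,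
            Complex.re_sum, Complex.real_smul, Complex.re_ofReal_mul, Finset.mul_sum]
          rw [Finset.sum_comm, Finset.sum_comm (s := (Finset.univ : Finset (Fin M)))]
          refine Finset.sum_congr rfl fun t _ => ?_
          rw [Finset.sum_comm]
          refine Finset.sum_congr rfl fun m _ => Finset.sum_congr rfl fun s _ => ?_
          simp only [herr]
          ring
        rw [e1]
        refine hpack.trans ?_
        have e2 : ∑ t, ∑ u, P.pU t u * (trace ((1 - Λ u) * P.outTU N t u)).re =
            1 - (trace (P.test N c * P.stateUB N)).re := by
          rw [Finset.sum_comm]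
          have hu : ∀ u, ∑ t, P.pU t u * (trace ((1 - Λ u) * P.outTU N t u)).re =
              P.distU N u - (trace (Λ u * P.outU N u)).re := by
            intro u
            have := congrArg Complex.re (P.trace_outU N u)
            rw [Complex.ofReal_re] at this
            rw [← this, ← Complex.sub_re, ← trace_sub]
            nth_rewrite 1 [← Matrix.one_mul (P.outU N u)]
            rw [← Matrix.sub_mul]
            simp only [AuxKernels.outU, Matrix.mul_sum, Matrix.mul_smul, trace_sum, trace_smul,
              Complex.re_sum, Complex.real_smul, Complex.re_ofReal_mul]
          simp only [hu, Finset.sum_sub_distrib, (P.distU_mem N).2]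
          rw [P.stateUB_eq N, trace_mul_cqMatrix, Complex.re_sum]
        -- For an independent competitor v the averaged output is Θ^B, so this is the acceptance
        -- probability of the product state.
        have e3 : ∑ t, ∑ u, P.pU t u *
            ∑ v, P.distU N v * (trace (Λ v * P.outTU N t u)).re ≤ 1 / c := by
          refine le_of_eq_of_le ?_ (P.trace_test_mul_product_le N hc)
          rw [P.stateU_kronecker_stateB N, trace_mul_cqMatrix, P.stateB_eq N]
          simp only [AuxKernels.outU, Matrix.mul_smul, trace_sum, trace_smul,
            Complex.re_sum, Complex.real_smul, Complex.re_ofReal_mul, Finset.mul_sum]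
          rw [Finset.sum_comm, Finset.sum_comm_cycle]
          refine Finset.sum_congr rfl fun v _ => ?_
          refine Finset.sum_congr rfl fun u _ => Finset.sum_congr rfl fun t _ => ?_
          ring
        rw [e2, (P.distT_mem N).2, mul_one]
        gcongr

end


noncomputable section

set_option linter.unusedSectionVars false

/-! ### Tails of the information density -/

section InfoDensity

theorem tendsto_two_rpow_mul {x : ℝ} (hx : x < 0) :
    Tendsto (fun n : ℕ => (2 : ℝ) ^ ((n : ℝ) * x)) atTop (𝓝 0) := by
  have h : ∀ n : ℕ, (2 : ℝ) ^ ((n : ℝ) * x) = ((2 : ℝ) ^ x) ^ n := fun n => by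
    rw [mul_comm, Real.rpow_mul two_pos.le, Real.rpow_natCast]
  simp only [h]
  exact tendsto_pow_atTop_nhds_zero_of_lt_one (by positivity)
    (Real.rpow_lt_one_of_one_lt_of_neg one_lt_two hx)

variable {A C : Type*} [Fintype A] [Fintype C] {p : A → C → ℝ}

theorem le_marginalFst (hp : ∀ a c, 0 ≤ p a c) (a : A) (c : C) : p a c ≤ marginalFst p a :=
  Finset.single_le_sum (fun c _ => hp a c) (Finset.mem_univ c)

theorem le_marginalSnd (hp : ∀ a c, 0 ≤ p a c) (a : A) (c : C) : p a c ≤ marginalSnd p c :=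
  Finset.single_le_sum (f := fun a => p a c) (fun a _ => hp a c) (Finset.mem_univ a)

theorem lt_infoDensity_iff (hp : ∀ a c, 0 ≤ p a c) {n : ℕ} (hn : 0 < n) (x : ℝ) {a : A} {c : C}
    (hac : 0 < p a c) :
    x < (1 / (n : ℝ)) * Real.logb 2 (p a c / (marginalFst p a * marginalSnd p c)) ↔
      (2 : ℝ) ^ ((n : ℝ) * x) * (marginalFst p a * marginalSnd p c) < p a c := by
  have hn' : (0 : ℝ) < n := Nat.cast_pos.mpr hn
  have hm : 0 < marginalFst p a * marginalSnd p c :=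
    mul_pos (hac.trans_le (le_marginalFst hp a c)) (hac.trans_le (le_marginalSnd hp a c))
  rw [one_div, lt_inv_mul_iff₀ hn', Real.lt_logb_iff_rpow_lt one_lt_two (div_pos hac hm),
    lt_div_iff₀ hm]

open Classical in
theorem probInfoDensityGT_eq (hp : ∀ a c, 0 ≤ p a c) {n : ℕ} (hn : 0 < n) (x : ℝ) :
    probInfoDensityGT n p x = ∑ a, ∑ c,
      if (2 : ℝ) ^ ((n : ℝ) * x) * (marginalFst p a * marginalSnd p c) < p a c then p a c
      else 0 := by
  refine Finset.sum_congr rfl fun a _ => Finset.sum_congr rfl fun c _ => ?_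
  rcases (hp a c).eq_or_lt with h | h
  · simp [← h]
  · simp only [lt_infoDensity_iff hp hn x h]

theorem probInfoDensityGT_nonneg (hp : ∀ a c, 0 ≤ p a c) (n : ℕ) (x : ℝ) :
    0 ≤ probInfoDensityGT n p x :=
  Finset.sum_nonneg fun a _ => Finset.sum_nonneg fun c _ => by
    split_ifs; exacts [hp a c, le_rfl]

/-- Where p ≤ 2^(nx) p_A p_C, the total mass of p is at most 2^(nx). -/
theorem one_sub_le_probInfoDensityGT (hp : ∀ a c, 0 ≤ p a c) (h1 : ∑ a, ∑ c, p a c = 1) {n : ℕ}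
    (hn : 0 < n) (x : ℝ) : 1 - (2 : ℝ) ^ ((n : ℝ) * x) ≤ probInfoDensityGT n p x := by
  classical
  have hm : ∑ a, ∑ c, marginalFst p a * marginalSnd p c = 1 := by
    simp only [← Finset.mul_sum, ← Finset.sum_mul]
    have h2 : ∑ c, marginalSnd p c = 1 := by
      simp only [marginalSnd]; rw [Finset.sum_comm, h1]
    rw [h2, mul_one]
    exact h1
  rw [probInfoDensityGT_eq hp hn, sub_le_iff_le_add]
  have hsum : ∑ a, ∑ c, (2 : ℝ) ^ ((n : ℝ) * x) * (marginalFst p a * marginalSnd p c) =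
      (2 : ℝ) ^ ((n : ℝ) * x) := by
    simp only [← Finset.mul_sum _ _ ((2 : ℝ) ^ ((n : ℝ) * x)), hm, mul_one]
  refine h1.symm.trans_le ((?_ : _ ≤ _).trans_eq (congrArg _ hsum))
  simp only [← Finset.sum_add_distrib]
  refine Finset.sum_le_sum fun a _ => Finset.sum_le_sum fun c _ => ?_
  have h0 : 0 ≤ marginalFst p a * marginalSnd p c :=
    mul_nonneg (Finset.sum_nonneg fun c _ => hp a c) (Finset.sum_nonneg fun a _ => hp a c)
  split_ifs with h
  · exact le_add_of_nonneg_right (by positivity)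
  · linarith

end InfoDensity

/-- Ensures that the ratios K = 2^(nb), 2^(nc) in the rejection sampling are at least 1. -/
theorem nonneg_of_tendsto_probInfoDensityGT {A C : ℕ → Type*} [∀ n, Fintype (A n)]
    [∀ n, Fintype (C n)] {p : ∀ n, A n → C n → ℝ} (hp : ∀ n a c, 0 ≤ p n a c)
    (h1 : ∀ n, ∑ a, ∑ c, p n a c = 1) {x : ℝ}
    (h : ∀ γ : ℝ, 0 < γ → Tendsto (fun n : ℕ => probInfoDensityGT n (p n) (x + γ)) atTop (𝓝 0)) :
    0 ≤ x := by
  by_contra! hx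
  have h2 := h (-x / 2) (by linarith)
  have h3 : Tendsto (fun n : ℕ => 1 - (2 : ℝ) ^ ((n : ℝ) * (x + -x / 2))) atTop (𝓝 (1 - 0)) :=
    (tendsto_two_rpow_mul (by linarith)).const_sub 1
  have := le_of_tendsto_of_tendsto h3 h2 (by
    filter_upwards [eventually_gt_atTop 0] with n hn
    exact one_sub_le_probInfoDensityGT (hp n) (h1 n) hn _)
  linarith

/-! ### Direct part -/

variable {X S B : Type*} [Fintype X] [DecidableEq X] [Fintype S] [DecidableEq S]
  [Fintype B] [DecidableEq B]

namespace AuxKernels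

variable {T U : Type*} [Fintype T] [DecidableEq T] [Fintype U] [DecidableEq U] {n : ℕ}
  (N : ChannelSeq X S B) (P : AuxKernels X S T U n)

theorem jointST_nonneg (s : Fin n → S) (t : T) : 0 ≤ P.jointST N s t := by
  rw [jointST_eq]
  exact mul_nonneg ((N.stateDist_mem n).1 s) ((P.pT_mem s).1 t)

theorem jointUT_nonneg (u : U) (t : T) : 0 ≤ P.jointUT N u t := by
  rw [jointUT_eq]
  exact mul_nonneg ((P.distT_mem N).1 t) ((P.pU_mem t).1 u)

theorem sum_jointST : ∑ s, ∑ t, P.jointST N s t = 1 := by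
  have := fun s => P.marginalFst_jointST N s
  simp only [marginalFst] at this
  simp only [this, (N.stateDist_mem n).2]

theorem sum_jointUT : ∑ u, ∑ t, P.jointUT N u t = 1 := by
  have := fun u => P.marginalFst_jointUT N u
  simp only [marginalFst] at this
  simp only [this, (P.distU_mem N).2]

/-- For p(s) > 0, p(t|s) > K p(t) is the same event as p(s,t) > K p(s)p(t), so the average excess
mass is a tail of the information density. -/
theorem sum_excessMass_pT_le (hn : 0 < n) (x : ℝ) :
    ∑ s, N.stateDist n s * excessMass (P.distT N) (P.pT s) ((2 : ℝ) ^ ((n : ℝ) * x)) ≤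
      probInfoDensityGT n (P.jointST N) x := by
  classical
  rw [probInfoDensityGT_eq (P.jointST_nonneg N) hn]
  refine Finset.sum_le_sum fun s _ => ?_
  rw [excessMass, Finset.mul_sum]
  refine Finset.sum_le_sum fun t _ => ?_
  rw [marginalFst_jointST, marginalSnd_jointST, jointST_eq]
  rcases ((N.stateDist_mem n).1 s).eq_or_lt with h | h
  · simp [← h]
  · rw [mul_left_comm]
    simp only [mul_lt_mul_iff_right₀ h, mul_ite, mul_zero]
    exact le_rfl

theorem sum_excessMass_pU_le (hn : 0 < n) (x : ℝ) :
    ∑ t, P.distT N t * excessMass (P.distU N) (P.pU t) ((2 : ℝ) ^ ((n : ℝ) * x)) ≤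
      probInfoDensityGT n (P.jointUT N) x := by
  classical
  rw [probInfoDensityGT_eq (P.jointUT_nonneg N) hn, Finset.sum_comm]
  refine Finset.sum_le_sum fun t _ => ?_
  rw [excessMass, Finset.mul_sum]
  refine Finset.sum_le_sum fun u _ => ?_
  rw [marginalFst_jointUT, marginalSnd_jointUT, jointUT_eq]
  rcases ((P.distT_mem N).1 t).eq_or_lt with h | h
  · simp [← h]
  · rw [mul_comm (P.distU N u), mul_left_comm]
    simp only [mul_lt_mul_iff_right₀ h, mul_ite, mul_zero]
    exact le_rfl

end AuxKernels

theorem sum_mul_one_sub_div_pow_le {A : Type*} [Fintype A] {p : A → ℝ} (hp : p ∈ stdSimplex ℝ A)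
    {e : A → ℝ} (he0 : ∀ a, 0 ≤ e a) (he1 : ∀ a, e a ≤ 1) {K L : ℝ} (hK : 1 ≤ K) {J : ℕ}
    (hJ : L * K ≤ J) :
    ∑ a, p a * (1 - (1 - e a) / K) ^ J ≤ ∑ a, p a * e a + Real.exp (-L) := by
  have hK0 : 0 < K := one_pos.trans_le hK
  calc _ ≤ ∑ a, p a * (e a + Real.exp (-L)) :=
        Finset.sum_le_sum fun a _ => mul_le_mul_of_nonneg_left
          (one_sub_div_pow_le (he0 a) (he1 a) hK0 (by
            rw [sub_nonneg, div_le_one hK0]; linarith [he0 a]) hJ) (hp.1 a)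
    _ = _ := by simp only [mul_add, Finset.sum_add_distrib, ← Finset.sum_mul, hp.2, one_mul]

theorem Code.error_eq_zero_of_M_eq_one {n : ℕ} (C : Code X S B n) (N : ChannelSeq X S B)
    (h : C.M = 1) : C.error N = 0 := by
  have : Subsingleton (Fin C.M) := by rw [h]; infer_instance
  have hp : ∀ m, C.povm m = 1 := fun m => by
    rw [← C.povm_sum, Fintype.sum_subsingleton _ m]
  simp [Code.error, hp]

/-- Quantitative form of the random coding bound at blocklength `n`. -/
theorem exists_code_of_rates {T U : Type*} [Fintype T] [DecidableEq T] [Fintype U] [DecidableEq U]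
    {n : ℕ} (hn : 0 < n) (N : ChannelSeq X S B) (P : AuxKernels X S T U n)
    {a b c R L L' δ : ℝ} (hb : 0 ≤ b) (hc : 0 ≤ c) (hR : 0 ≤ R) (hL : 0 < L) (hL' : 0 < L')
    (hδ : 0 < δ) :
    ∃ C : Code X S B n, (2 : ℝ) ^ ((n : ℝ) * R) ≤ C.M ∧
      (C.Me : ℝ) ≤ (L' + 1) * (2 : ℝ) ^ ((n : ℝ) * c) ∧
      C.error N ≤ (L' + 1) * ((L + 1) * (2 * (1 - (trace (P.test N ((2 : ℝ) ^ ((n : ℝ) * a)) *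
          P.stateUB N)).re) + 4 * (2 * (L + 1) * (2 : ℝ) ^ ((n : ℝ) * (R + b - a)) + δ)) +
        (probInfoDensityGT n (P.jointUT N) b + Real.exp (-L))) +
        (probInfoDensityGT n (P.jointST N) c + Real.exp (-L')) := by
  have hpos : ∀ x : ℝ, (0 : ℝ) < (2 : ℝ) ^ ((n : ℝ) * x) := fun x => by positivity
  have hone : ∀ x : ℝ, 0 ≤ x → (1 : ℝ) ≤ (2 : ℝ) ^ ((n : ℝ) * x) := fun x hx =>
    Real.one_le_rpow one_le_two (by positivity)
  have hceil : ∀ x : ℝ, 0 ≤ x → ∀ l : ℝ, 0 < l →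
      (⌈l * (2 : ℝ) ^ ((n : ℝ) * x)⌉₊ : ℝ) ≤ (l + 1) * (2 : ℝ) ^ ((n : ℝ) * x) := fun x hx l hl => by
    have := (Nat.ceil_lt_add_one (mul_pos hl (hpos x)).le).le
    linarith [hone x hx]
  obtain ⟨C, hM, hMe, herr⟩ := exists_code N P (hpos b) (hpos c) (hpos a) hδ
    (M := ⌈1 * (2 : ℝ) ^ ((n : ℝ) * R)⌉₊) (J := ⌈L * (2 : ℝ) ^ ((n : ℝ) * b)⌉₊)
    (Me := ⌈L' * (2 : ℝ) ^ ((n : ℝ) * c)⌉₊) (Nat.ceil_pos.mpr (mul_pos one_pos (hpos _)))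
    (Nat.ceil_pos.mpr (mul_pos hL (hpos _))) (Nat.ceil_pos.mpr (mul_pos hL' (hpos _)))
  refine ⟨C, ?_, ?_, herr.trans ?_⟩
  · rw [hM, one_mul]; exact Nat.le_ceil _
  · rw [hMe]; exact hceil c hc L' hL'
  · have hτ := P.trace_test_mul_stateUB_le_one N ((2 : ℝ) ^ ((n : ℝ) * a))
    have hU := (sum_mul_one_sub_div_pow_le (P.distT_mem N)
      (fun t => excessMass_nonneg (P.pU_mem t).1) (fun t => excessMass_le_one (P.pU_mem t).1
        (P.pU_mem t).2) (hone b hb) (Nat.le_ceil (L * (2 : ℝ) ^ ((n : ℝ) * b)))).trans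
      (add_le_add_left (P.sum_excessMass_pU_le N hn b) _)
    have hT := (sum_mul_one_sub_div_pow_le (N.stateDist_mem n)
      (fun t => excessMass_nonneg (P.pT_mem t).1) (fun t => excessMass_le_one (P.pT_mem t).1
        (P.pT_mem t).2) (hone c hc) (Nat.le_ceil (L' * (2 : ℝ) ^ ((n : ℝ) * c)))).trans
      (add_le_add_left (P.sum_excessMass_pT_le N hn c) _)
    have hU0 := probInfoDensityGT_nonneg (P.jointUT_nonneg N) n b
    -- Rounding up costs the factors 1 + 1 for M and L + 1 for J.
    have hMJ : (⌈1 * (2 : ℝ) ^ ((n : ℝ) * R)⌉₊ : ℝ) * (⌈L * (2 : ℝ) ^ ((n : ℝ) * b)⌉₊ : ℝ) *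
        (1 / (2 : ℝ) ^ ((n : ℝ) * a)) ≤ 2 * (L + 1) * (2 : ℝ) ^ ((n : ℝ) * (R + b - a)) := by
      have e : (2 : ℝ) ^ ((n : ℝ) * (R + b - a)) =
          (2 : ℝ) ^ ((n : ℝ) * R) * (2 : ℝ) ^ ((n : ℝ) * b) * (1 / (2 : ℝ) ^ ((n : ℝ) * a)) := by
        rw [mul_one_div, ← Real.rpow_add two_pos, ← Real.rpow_sub two_pos]
        ring_nf
      rw [e, show 2 * (L + 1) * ((2 : ℝ) ^ ((n : ℝ) * R) * (2 : ℝ) ^ ((n : ℝ) * b) *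
        (1 / (2 : ℝ) ^ ((n : ℝ) * a))) = ((1 + 1) * (2 : ℝ) ^ ((n : ℝ) * R)) *
        ((L + 1) * (2 : ℝ) ^ ((n : ℝ) * b)) * (1 / (2 : ℝ) ^ ((n : ℝ) * a)) by ring]
      have h1 := hceil R hR 1 one_pos
      have h2 := hceil b hb L hL
      gcongr
    have hJ : (⌈L * (2 : ℝ) ^ ((n : ℝ) * b)⌉₊ : ℝ) / (2 : ℝ) ^ ((n : ℝ) * b) ≤ L + 1 :=
      (div_le_iff₀ (hpos b)).mpr (hceil b hb L hL)
    have hMe' : (⌈L' * (2 : ℝ) ^ ((n : ℝ) * c)⌉₊ : ℝ) / (2 : ℝ) ^ ((n : ℝ) * c) ≤ L' + 1 :=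
      (div_le_iff₀ (hpos c)).mpr (hceil c hc L' hL')
    have hinner := mul_le_mul hJ (add_le_add le_rfl (mul_le_mul_of_nonneg_left
      (add_le_add_left hMJ δ) (by norm_num : (0 : ℝ) ≤ 4)) : 2 * (1 - (trace (P.test N
      ((2 : ℝ) ^ ((n : ℝ) * a)) * P.stateUB N)).re) + _ ≤ _)
      (by
        have : (0 : ℝ) ≤ (⌈1 * (2 : ℝ) ^ ((n : ℝ) * R)⌉₊ : ℝ) *
          (⌈L * (2 : ℝ) ^ ((n : ℝ) * b)⌉₊ : ℝ) * (1 / (2 : ℝ) ^ ((n : ℝ) * a)) := by positivity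
        linarith) (by linarith)
    have hrhs : 0 ≤ (L + 1) * (2 * (1 - (trace (P.test N ((2 : ℝ) ^ ((n : ℝ) * a)) *
          P.stateUB N)).re) + 4 * (2 * (L + 1) * (2 : ℝ) ^ ((n : ℝ) * (R + b - a)) + δ)) := by
      have := hpos (R + b - a)
      have : 0 ≤ 2 * (L + 1) * (2 : ℝ) ^ ((n : ℝ) * (R + b - a)) := by positivity
      exact mul_nonneg (by linarith) (by linarith)
    refine add_le_add ?_ hT
    refine (mul_le_mul_of_nonneg_left (add_le_add hinner hU) (by positivity)).trans ?_
    refine mul_le_mul_of_nonneg_right hMe' ?_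
    have := Real.exp_pos (-L)
    linarith

end


noncomputable section

set_option linter.unusedSectionVars false

variable {X S B : Type*} [Fintype X] [DecidableEq X] [Fintype S] [DecidableEq S]
  [Fintype B] [DecidableEq B]

/-! ### From the one-shot bound to achievable rates. -/

section Direct

variable {T U : ℕ → Type*} [∀ n, Fintype (T n)] [∀ n, DecidableEq (T n)]
  [∀ n, Fintype (U n)] [∀ n, DecidableEq (U n)]

/-- A single message is decoded without error. The kernels enter only to guarantee that a code
exists. -/
theorem achievable_of_neg (N : ChannelSeq X S B) (P : ∀ n, AuxKernels X S (T n) (U n) n) {R RS : ℝ}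
    (hR : R < 0) (hRS : 0 < RS) : Achievable N R RS := by
  intro ε hε
  have hC : ∀ n, ∃ C : Code X S B n, C.M = 1 ∧ C.Me = 1 := fun n => by
    obtain ⟨C, hM, hMe, -⟩ := exists_code N (P n) one_pos one_pos one_pos one_pos
      one_pos one_pos one_pos
    exact ⟨C, hM, hMe⟩
  choose C hM hMe using hC
  refine ⟨C, fun _ => 0, fun n => (Code.error_eq_zero_of_M_eq_one _ N (hM n)).le, ?_, ?_, ?_⟩
  · simpa [hM] using hR
  · simpa using hε
  · simpa [hMe] using hRS

theorem achievable_of_rates (N : ChannelSeq X S B) (P : ∀ n, AuxKernels X S (T n) (U n) n)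
    {a b c R RS : ℝ}
    (ha : ∀ γ : ℝ, 0 < γ → Tendsto (fun n : ℕ => (trace ((P n).test N
      ((2 : ℝ) ^ ((n : ℝ) * (a - γ))) * (P n).stateUB N)).re) atTop (𝓝 1))
    (hb : ∀ γ : ℝ, 0 < γ → Tendsto (fun n : ℕ => probInfoDensityGT n ((P n).jointUT N) (b + γ))
      atTop (𝓝 0))
    (hc : ∀ γ : ℝ, 0 < γ → Tendsto (fun n : ℕ => probInfoDensityGT n ((P n).jointST N) (c + γ))
      atTop (𝓝 0))
    (hR : R < a - b) (hRS : c < RS) : Achievable N R RS := by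
  have hb0 : 0 ≤ b := nonneg_of_tendsto_probInfoDensityGT (fun n => (P n).jointUT_nonneg N)
    (fun n => (P n).sum_jointUT N) hb
  have hc0 : 0 ≤ c := nonneg_of_tendsto_probInfoDensityGT (fun n => (P n).jointST_nonneg N)
    (fun n => (P n).sum_jointST N) hc
  rcases lt_or_ge R 0 with hR0 | hR0
  · exact achievable_of_neg N P hR0 (hc0.trans_lt hRS)
  intro ε hε
  -- The exponent R + γ + (b + γ) - (a - γ) must be negative, which takes more than 3γ of room; on
  -- the state side c + 2γ < RS is needed.
  obtain ⟨γ, hγ, hγR, hγS⟩ : ∃ γ : ℝ, 0 < γ ∧ 4 * γ ≤ a - b - R ∧ 4 * γ ≤ RS - c :=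
    ⟨min ((a - b - R) / 4) ((RS - c) / 4), lt_min (by linarith) (by linarith),
      by linarith [min_le_left ((a - b - R) / 4) ((RS - c) / 4)],
      by linarith [min_le_right ((a - b - R) / 4) ((RS - c) / 4)]⟩
  have hexp : ∀ η : ℝ, 0 < η → ∃ L : ℝ, 0 < L ∧ Real.exp (-L) < η := fun η hη => by
    have := (Real.tendsto_exp_neg_atTop_nhds_zero.eventually_lt_const hη).and
      (eventually_gt_atTop 0)
    obtain ⟨L, h1, h2⟩ := this.exists
    exact ⟨L, h2, h1⟩
  -- L' comes before L, because the failure term e^(-L) of the inner layer is multiplied by L' + 1.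
  obtain ⟨L', hL', hL'ε⟩ := hexp (ε / 4) (by linarith)
  obtain ⟨L, hL, hLε⟩ := hexp (ε / 4 / (L' + 1)) (by positivity)
  set δ : ℕ → ℝ := fun n => 1 / ((n : ℝ) + 1) with hδ
  set bound : ℕ → ℝ := fun n => (L' + 1) * ((L + 1) * (2 * (1 - (trace ((P n).test N
      ((2 : ℝ) ^ ((n : ℝ) * (a - γ))) * (P n).stateUB N)).re) +
        4 * (2 * (L + 1) * (2 : ℝ) ^ ((n : ℝ) * (R + γ + (b + γ) - (a - γ))) + δ n)) +
      (probInfoDensityGT n ((P n).jointUT N) (b + γ) + Real.exp (-L))) +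
      (probInfoDensityGT n ((P n).jointST N) (c + γ) + Real.exp (-L')) with hbound
  have hlim : Tendsto bound atTop (𝓝 ((L' + 1) * ((L + 1) * (2 * (1 - 1) +
      4 * (2 * (L + 1) * 0 + 0)) + (0 + Real.exp (-L))) + (0 + Real.exp (-L')))) := by
    refine Tendsto.add (Tendsto.const_mul _ (Tendsto.add (Tendsto.const_mul _ (Tendsto.add
      (((ha γ hγ).const_sub 1).const_mul 2) (Tendsto.const_mul _ (Tendsto.add
        (Tendsto.const_mul _ (tendsto_two_rpow_mul (by linarith)))
        tendsto_one_div_add_atTop_nhds_zero_nat)))) ((hb γ hγ).add_const _)))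
      ((hc γ hγ).add_const _)
  have hlim_lt : (L' + 1) * ((L + 1) * (2 * (1 - 1) +
      4 * (2 * (L + 1) * 0 + 0)) + (0 + Real.exp (-L))) + (0 + Real.exp (-L')) < ε / 2 := by
    have := (lt_div_iff₀' (by positivity)).mp hLε
    nlinarith
  have hC : ∀ n, ∃ C : Code X S B n, 0 < n → (2 : ℝ) ^ ((n : ℝ) * (R + γ)) ≤ C.M ∧
      (C.Me : ℝ) ≤ (L' + 1) * (2 : ℝ) ^ ((n : ℝ) * (c + γ)) ∧ C.error N ≤ bound n := fun n => by
    rcases Nat.eq_zero_or_pos n with hn | hn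
    · obtain ⟨C, -⟩ := exists_code N (P n) one_pos one_pos one_pos one_pos
        one_pos one_pos one_pos
      exact ⟨C, fun h => absurd hn h.ne'⟩
    · obtain ⟨C, hC⟩ := exists_code_of_rates hn N (P n) (a := a - γ) (by linarith : 0 ≤ b + γ)
        (by linarith : 0 ≤ c + γ) (by linarith : 0 ≤ R + γ) hL hL'
        (by positivity : 0 < δ n)
      exact ⟨C, fun _ => hC⟩
  choose C hC using hC
  refine ⟨C, fun n => (C n).error N, fun n => le_rfl, ?_, ?_, ?_⟩
  · refine lt_of_lt_of_le (EReal.coe_lt_coe_iff.mpr (by linarith : R < R + γ))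
      (le_liminf_of_le (by isBoundedDefault) ?_)
    filter_upwards [eventually_gt_atTop 0] with n hn
    have hn' : (0 : ℝ) < n := Nat.cast_pos.mpr hn
    rw [EReal.coe_le_coe_iff, one_div, le_inv_mul_iff₀ hn',
      Real.le_logb_iff_rpow_le one_lt_two (Nat.cast_pos.mpr (C n).M_pos)]
    exact (hC n hn).1
  · refine lt_of_le_of_lt (limsup_le_of_le (by isBoundedDefault) ?_)
      (EReal.coe_lt_coe_iff.mpr (by linarith : ε / 2 < ε))
    filter_upwards [eventually_gt_atTop 0, hlim.eventually_lt_const hlim_lt] with n hn h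
    exact EReal.coe_le_coe_iff.mpr ((hC n hn).2.2.trans h.le)
  · refine lt_of_le_of_lt (limsup_le_of_le (by isBoundedDefault) ?_)
      (EReal.coe_lt_coe_iff.mpr (by linarith : c + 2 * γ < RS))
    have hlog : Tendsto (fun n : ℕ => Real.logb 2 (L' + 1) * (1 / (n : ℝ))) atTop (𝓝 _) :=
      tendsto_one_div_atTop_nhds_zero_nat.const_mul _
    rw [mul_zero] at hlog
    filter_upwards [eventually_gt_atTop 0, hlog.eventually_lt_const hγ] with n hn h
    have hn' : (0 : ℝ) < n := Nat.cast_pos.mpr hn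
    rw [EReal.coe_le_coe_iff]
    have h1 := Real.logb_le_logb_of_le one_lt_two (Nat.cast_pos.mpr (C n).Me_pos) (hC n hn).2.1
    rw [Real.logb_mul (by positivity) (by positivity), Real.logb_rpow two_pos (by norm_num)] at h1
    rw [mul_one_div, div_lt_iff₀ hn'] at h
    rw [one_div, inv_mul_le_iff₀ hn']
    linarith

end Direct

/-- A difference of extended reals above a real number has left side above ⊥ and right side below ⊤
(⊤ - ⊤ is ⊥), so both sets contain real members. -/
theorem exists_lt_sub_of_le_sSup_sub_sInf {p q : ℝ → Prop} {r : ℝ}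
    (h : (r : EReal) ≤ sSup {e : EReal | ∃ a : ℝ, e = (a : EReal) ∧ p a} -
      sInf {e : EReal | ∃ b : ℝ, e = (b : EReal) ∧ q b}) {δ : ℝ} (hδ : 0 < δ) :
    ∃ a b : ℝ, p a ∧ q b ∧ r - δ < a - b := by
  have h1 := EReal.add_lt_of_lt_sub
    ((EReal.coe_lt_coe_iff.mpr (by linarith : r - δ < r)).trans_le h)
  obtain ⟨_, ⟨a, rfl, ha⟩, h2⟩ := lt_sSup_iff.mp h1
  rw [add_comm, ← EReal.lt_sub_iff_add_lt (Or.inl (EReal.coe_ne_bot _))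
    (Or.inl (EReal.coe_ne_top _))] at h2
  obtain ⟨_, ⟨b, rfl, hb⟩, h3⟩ := sInf_lt_iff.mp h2
  refine ⟨a, b, ha, hb, ?_⟩
  rw [← EReal.coe_sub, EReal.coe_lt_coe_iff] at h3
  linarith

theorem mem_capacityRegion_of_le (N : ChannelSeq X S B) {t u : ℕ → ℕ}
    (P : ∀ n, AuxKernels X S (Fin (t n)) (Fin (u n)) n) {r : ℝ × ℝ}
    (h1 : (r.1 : EReal) ≤ infoUB N P - infoUT N P) (h2 : infoST N P ≤ (r.2 : EReal)) :
    r ∈ capacityRegion N := by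
  have hach : ∀ δ : ℝ, 0 < δ → Achievable N (r.1 - δ) (r.2 + δ) := by
    intro δ hδ
    obtain ⟨a, b, ha, hb, hab⟩ := exists_lt_sub_of_le_sSup_sub_sInf h1 hδ
    obtain ⟨_, ⟨c, rfl, hc⟩, hc2⟩ := sInf_lt_iff.mp
      (h2.trans_lt (EReal.coe_lt_coe_iff.mpr (by linarith : r.2 < r.2 + δ)))
    exact achievable_of_rates N P ha hb hc hab (EReal.coe_lt_coe_iff.mp hc2)
  have hlim : Tendsto (fun n : ℕ => (r.1 - 1 / ((n : ℝ) + 1), r.2 + 1 / ((n : ℝ) + 1))) atTop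
      (𝓝 (r.1 - 0, r.2 + 0)) :=
    (tendsto_one_div_add_atTop_nhds_zero_nat.const_sub _).prodMk_nhds
      (tendsto_one_div_add_atTop_nhds_zero_nat.const_add _)
  rw [sub_zero, add_zero] at hlim
  exact mem_closure_of_tendsto hlim (Eventually.of_forall fun n => hach _ (by positivity))

end


noncomputable section

set_option linter.unusedSectionVars false

/-! ### Converse part -/

/-- φ n is the largest k ≤ n for which `p k n` holds. -/
theorem exists_tendsto_eventually_diagonal {p : ℕ → ℕ → Prop} (h : ∀ k, ∀ᶠ n in atTop, p k n) :
    ∃ φ : ℕ → ℕ, Tendsto φ atTop atTop ∧ ∀ᶠ n in atTop, p (φ n) n := by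
  classical
  refine ⟨fun n => Nat.findGreatest (fun k => p k n) n, tendsto_atTop.mpr fun k => ?_, ?_⟩
  · filter_upwards [h k, eventually_ge_atTop k] with n hn hk
    exact Nat.le_findGreatest hk hn
  · filter_upwards [h 0] with n hn
    exact Nat.findGreatest_spec (P := fun k => p k n) (Nat.zero_le n) hn

/-- Since p(a,c) ≤ p(a), a pair of density above x forces p(c) < 2^(-nx), and each such c
contributes at most p(c). -/
theorem probInfoDensityGT_le_card_mul {A C : Type*} [Fintype A] [Fintype C] {p : A → C → ℝ}
    (hp : ∀ a c, 0 ≤ p a c) {n : ℕ} (hn : 0 < n) (x : ℝ) :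
    probInfoDensityGT n p x ≤ Fintype.card C * (2 : ℝ) ^ ((n : ℝ) * -x) := by
  classical
  rw [probInfoDensityGT_eq hp hn, Finset.sum_comm, mul_neg, Real.rpow_neg two_pos.le]
  have hpos : (0 : ℝ) < (2 : ℝ) ^ ((n : ℝ) * x) := by positivity
  refine (Finset.sum_le_card_nsmul Finset.univ _ ((2 : ℝ) ^ ((n : ℝ) * x))⁻¹
    fun c _ => ?_).trans_eq (nsmul_eq_mul _ _)
  by_cases hc : (2 : ℝ) ^ ((n : ℝ) * x) * marginalSnd p c < 1
  · have hle : marginalSnd p c ≤ ((2 : ℝ) ^ ((n : ℝ) * x))⁻¹ := by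
      rw [← one_div, le_div_iff₀ hpos, mul_comm]
      exact hc.le
    refine (Finset.sum_le_sum (g := fun a => p a c) fun a _ => ?_).trans hle
    split_ifs
    exacts [le_rfl, hp a c]
  · rw [Finset.sum_eq_zero]
    · positivity
    · intro a _
      rw [if_neg]
      intro h
      apply hc
      have h1 := h.trans_le (le_marginalFst hp a c)
      have h2 : 0 ≤ marginalFst p a := (hp a c).trans (le_marginalFst hp a c)
      by_contra! h3
      nlinarith

variable {X S B : Type*} [Fintype X] [DecidableEq X] [Fintype S] [DecidableEq S]
  [Fintype B] [DecidableEq B]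

/-! ### Auxiliary variables induced by a code. -/

namespace Code

variable {n : ℕ} (C : Code X S B n)

/-- The conditional distributions induced by a code: `S̃` is the coded state, and `U` is the
uniformly distributed message. -/
def kernels : AuxKernels X S (Fin C.Me) (Fin C.M) n where
  pT s := Pi.single (C.stateEnc s) 1
  pT_mem s := single_mem_stdSimplex ℝ _
  pU _ _ := 1 / (C.M : ℝ)
  pU_mem _ := ⟨fun _ => by positivity, by
    simp [Finset.sum_const, (Nat.cast_pos.mpr C.M_pos : (0 : ℝ) < C.M).ne']⟩
  pX := C.enc
  pX_mem := C.enc_mem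

variable (N : ChannelSeq X S B)

theorem distU_kernels (m : Fin C.M) : C.kernels.distU N m = 1 / (C.M : ℝ) := by
  have := (C.kernels.distT_mem N).2
  rw [AuxKernels.distU]
  change ∑ t, C.kernels.distT N t * (1 / (C.M : ℝ)) = _
  rw [← Finset.sum_mul, this, one_mul]

theorem outU_kernels (m : Fin C.M) : C.kernels.outU N m = (1 / (C.M : ℝ)) •
    ∑ s, N.stateDist n s • ∑ x, C.enc m (C.stateEnc s) x • N.out x s := by
  change ∑ t, (1 / (C.M : ℝ)) • ∑ s, (N.stateDist n s * (Pi.single (C.stateEnc s) 1 : _ → ℝ) t) •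
    ∑ x, C.enc m t x • N.out x s = _
  rw [← Finset.smul_sum, Finset.sum_comm]
  congr 1
  refine Finset.sum_congr rfl fun s _ => ?_
  rw [Finset.sum_eq_single (C.stateEnc s)]
  · simp
  · intro t _ ht
    simp [Pi.single_eq_of_ne ht]
  · simp

/-- The block-diagonal operator built from the POVM is the test "the decoder outputs U". -/
theorem trace_povm_mul_stateUB :
    (trace (cqMatrix C.povm * C.kernels.stateUB N)).re = 1 - C.error N := by
  have h1 : (trace (cqMatrix (fun m => 1 - C.povm m) * C.kernels.stateUB N)).re = C.error N := by
    rw [AuxKernels.stateUB_eq, trace_mul_cqMatrix, error_eq, Complex.re_sum, Finset.mul_sum]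
    refine Finset.sum_congr rfl fun m _ => ?_
    rw [cqMatrix_submatrix, outU_kernels, Matrix.mul_smul, trace_smul, Complex.real_smul,
      Complex.re_ofReal_mul]
    congr 1
    rw [Matrix.mul_sum, trace_sum, Complex.re_sum]
    refine Finset.sum_congr rfl fun s _ => ?_
    rw [Matrix.mul_smul, trace_smul, Complex.real_smul, Complex.re_ofReal_mul]
  rw [cqMatrix_sub, cqMatrix_one, Matrix.sub_mul, Matrix.one_mul, trace_sub, Complex.sub_re,
    AuxKernels.trace_stateUB, Complex.one_re] at h1
  linarith

/-- On the product state the decoder's guess is independent of the uniform message. -/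
theorem trace_povm_mul_product :
    (trace (cqMatrix C.povm * (C.kernels.stateU N ⊗ₖ C.kernels.stateB N))).re =
      1 / (C.M : ℝ) := by
  rw [AuxKernels.stateU_kronecker_stateB, trace_mul_cqMatrix, Complex.re_sum]
  simp only [cqMatrix_submatrix, distU_kernels, Matrix.mul_smul, trace_smul, Complex.real_smul,
    Complex.re_ofReal_mul]
  rw [← Finset.mul_sum, ← Complex.re_sum, ← trace_sum, ← Matrix.sum_mul, C.povm_sum,
    Matrix.one_mul, AuxKernels.trace_stateB, Complex.one_re, mul_one]

/-- Meta-converse: decoding is one particular test of Θ^{UB} against the product, and the spectral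
projection does at least as well. -/
theorem one_sub_error_sub_le {c : ℝ} (hc : 0 ≤ c) :
    1 - C.error N - c * (1 / (C.M : ℝ)) ≤
      (trace (C.kernels.test N c * C.kernels.stateUB N)).re := by
  rw [← trace_povm_mul_stateUB, ← trace_povm_mul_product C N]
  refine C.kernels.le_trace_test_mul_stateUB N hc (cqMatrix_posSemidef C.povm_posSemidef) ?_
  rw [← cqMatrix_one, ← cqMatrix_sub]
  refine cqMatrix_posSemidef fun m => ?_
  rw [← C.povm_sum, ← Finset.add_sum_erase _ _ (Finset.mem_univ m), add_sub_cancel_left]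
  exact posSemidef_sum _ fun i _ => C.povm_posSemidef i

/-- Message and coded state are independent, so the density is never positive. -/
theorem probInfoDensityGT_jointUT_kernels (hn : 0 < n) {x : ℝ} (hx : 0 ≤ x) :
    probInfoDensityGT n (C.kernels.jointUT N) x = 0 := by
  classical
  rw [probInfoDensityGT_eq (C.kernels.jointUT_nonneg N) hn]
  refine Finset.sum_eq_zero fun m _ => Finset.sum_eq_zero fun t _ => if_neg ?_
  rw [AuxKernels.marginalFst_jointUT, AuxKernels.marginalSnd_jointUT, AuxKernels.jointUT_eq,
    distU_kernels, not_lt, mul_comm (1 / (C.M : ℝ))]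
  refine le_mul_of_one_le_left (mul_nonneg ((C.kernels.distT_mem N).1 t)
    (one_div_nonneg.mpr (Nat.cast_nonneg _)))
    (Real.one_le_rpow one_le_two (mul_nonneg (Nat.cast_nonneg n) hx))

end Code

/-- For each k an achievable pair within 1/(k+1) of r supplies codes of error at most 1/(k+1) for
large n. Letting k grow slowly with n gives one sequence with vanishing slack. -/
theorem exists_codes_of_mem_capacityRegion (N : ChannelSeq X S B) {r : ℝ × ℝ}
    (hr : r ∈ capacityRegion N) : ∃ (C : ∀ n, Code X S B n) (η : ℕ → ℝ), Tendsto η atTop (𝓝 0) ∧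
      ∀ᶠ n : ℕ in atTop, (C n).error N ≤ η n ∧ (2 : ℝ) ^ ((n : ℝ) * (r.1 - η n)) ≤ (C n).M ∧
        ((C n).Me : ℝ) ≤ (2 : ℝ) ^ ((n : ℝ) * (r.2 + η n)) := by
  set δ : ℕ → ℝ := fun k => 1 / ((k : ℝ) + 1) with hδ
  have hδ0 : ∀ k, 0 < δ k := fun k => by positivity
  set q : ∀ _ n : ℕ, Code X S B n → Prop := fun k n C => C.error N ≤ δ k ∧
    (2 : ℝ) ^ ((n : ℝ) * (r.1 - δ k)) ≤ C.M ∧ (C.Me : ℝ) ≤ (2 : ℝ) ^ ((n : ℝ) * (r.2 + δ k)) with hq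
  have hseq : ∀ k, ∃ C : ∀ n, Code X S B n, ∀ᶠ n in atTop, q k n (C n) := by
    intro k
    obtain ⟨r', hr', hdist⟩ := Metric.mem_closure_iff.mp hr (δ k) (hδ0 k)
    rw [Prod.dist_eq, max_lt_iff, Real.dist_eq, Real.dist_eq, abs_lt, abs_lt] at hdist
    obtain ⟨C, e, herr, hM, he, hMe⟩ := hr' (δ k) (hδ0 k)
    refine ⟨C, ?_⟩
    filter_upwards [eventually_gt_atTop 0, eventually_lt_of_lt_liminf hM (by isBoundedDefault),
      eventually_lt_of_limsup_lt he (by isBoundedDefault),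
      eventually_lt_of_limsup_lt hMe (by isBoundedDefault)] with n hn h1 h2 h3
    have hn' : (0 : ℝ) < n := Nat.cast_pos.mpr hn
    rw [EReal.coe_lt_coe_iff] at h1 h2 h3
    rw [one_div, lt_inv_mul_iff₀ hn',
      Real.lt_logb_iff_rpow_lt one_lt_two (Nat.cast_pos.mpr (C n).M_pos)] at h1
    rw [one_div, inv_mul_lt_iff₀ hn',
      Real.logb_lt_iff_lt_rpow one_lt_two (Nat.cast_pos.mpr (C n).Me_pos)] at h3
    refine ⟨(herr n).trans h2.le, le_trans ?_ h1.le, h3.le.trans ?_⟩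
    · refine Real.rpow_le_rpow_of_exponent_le one_le_two (mul_le_mul_of_nonneg_left ?_ hn'.le)
      linarith [hdist.1.2]
    · refine Real.rpow_le_rpow_of_exponent_le one_le_two (mul_le_mul_of_nonneg_left ?_ hn'.le)
      linarith [hdist.2.1]
  obtain ⟨C₀, -⟩ := hseq 0
  obtain ⟨φ, hφ, hφq⟩ := exists_tendsto_eventually_diagonal
    (p := fun k n => ∃ C : Code X S B n, q k n C) fun k => by
      obtain ⟨C, hC⟩ := hseq k
      filter_upwards [hC] with n hn
      exact ⟨_, hn⟩
  have hC : ∀ n, ∃ C : Code X S B n, (∃ C' : Code X S B n, q (φ n) n C') → q (φ n) n C := fun n => by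
    by_cases h : ∃ C' : Code X S B n, q (φ n) n C'
    · exact ⟨h.choose, fun _ => h.choose_spec⟩
    · exact ⟨C₀ n, fun h' => absurd h' h⟩
  choose C hC using hC
  refine ⟨C, fun n => δ (φ n), tendsto_one_div_add_atTop_nhds_zero_nat.comp hφ, ?_⟩
  filter_upwards [hφq] with n hn
  exact hC n hn

theorem exists_kernels_of_mem_capacityRegion (N : ChannelSeq X S B) {r : ℝ × ℝ}
    (hr : r ∈ capacityRegion N) :
    ∃ (t u : ℕ → ℕ) (P : ∀ n, AuxKernels X S (Fin (t n)) (Fin (u n)) n),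
      (r.1 : EReal) ≤ infoUB N P - infoUT N P ∧ infoST N P ≤ (r.2 : EReal) := by
  obtain ⟨C, η, hη, hC⟩ := exists_codes_of_mem_capacityRegion N hr
  refine ⟨fun n => (C n).Me, fun n => (C n).M, fun n => (C n).kernels, ?_, ?_⟩
  · have hUT : infoUT N (fun n => (C n).kernels) ≤ 0 := by
      refine sInf_le ⟨0, EReal.coe_zero.symm, fun γ hγ => ?_⟩
      refine tendsto_const_nhds.congr' ?_
      filter_upwards [eventually_gt_atTop 0] with n hn
      exact ((C n).probInfoDensityGT_jointUT_kernels N hn (by linarith)).symm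
    have hUB : (r.1 : EReal) ≤ infoUB N (fun n => (C n).kernels) := by
      refine le_sSup ⟨r.1, rfl, fun γ hγ => ?_⟩
      have hlim : Tendsto (fun n : ℕ => 1 - η n - (2 : ℝ) ^ ((n : ℝ) * (-(γ / 2)))) atTop
          (𝓝 (1 - 0 - 0)) :=
        (hη.const_sub 1).sub (tendsto_two_rpow_mul (by linarith))
      rw [sub_zero, sub_zero] at hlim
      refine tendsto_of_tendsto_of_tendsto_of_le_of_le' hlim tendsto_const_nhds ?_
        (Eventually.of_forall fun n => (C n).kernels.trace_test_mul_stateUB_le_one N _)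
      filter_upwards [hC, hη.eventually_lt_const (half_pos hγ)] with n ⟨h1, h2, _⟩ h3
      refine le_trans ?_ ((C n).one_sub_error_sub_le N (by positivity))
      have hM : (0 : ℝ) < (C n).M := Nat.cast_pos.mpr (C n).M_pos
      -- The exponent is (r.1 - γ) - (r.1 - η n) = η n - γ, below -γ/2 once η n < γ/2.
      have : (2 : ℝ) ^ ((n : ℝ) * (r.1 - γ)) * (1 / ((C n).M : ℝ)) ≤
          (2 : ℝ) ^ ((n : ℝ) * (-(γ / 2))) := by
        rw [mul_one_div, div_le_iff₀ hM]
        refine le_trans ?_ (mul_le_mul_of_nonneg_left h2 (by positivity))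
        rw [← Real.rpow_add two_pos, ← mul_add]
        refine Real.rpow_le_rpow_of_exponent_le one_le_two
          (mul_le_mul_of_nonneg_left ?_ (Nat.cast_nonneg n))
        linarith
      linarith
    have := EReal.sub_le_sub hUB hUT
    rwa [sub_zero] at this
  · refine sInf_le ⟨r.2, rfl, fun γ hγ => ?_⟩
    refine tendsto_of_tendsto_of_tendsto_of_le_of_le' tendsto_const_nhds
      (tendsto_two_rpow_mul (by linarith : -(γ / 2) < 0))
      (Eventually.of_forall fun n =>
        probInfoDensityGT_nonneg ((C n).kernels.jointST_nonneg N) n _) ?_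
    filter_upwards [hC, hη.eventually_lt_const (half_pos hγ), eventually_gt_atTop 0]
      with n ⟨_, _, h2⟩ h3 hn
    refine (probInfoDensityGT_le_card_mul ((C n).kernels.jointST_nonneg N) hn _).trans ?_
    rw [Fintype.card_fin]
    refine (mul_le_mul_of_nonneg_right h2 (by positivity)).trans ?_
    rw [← Real.rpow_add two_pos, ← mul_add]
    refine Real.rpow_le_rpow_of_exponent_le one_le_two
      (mul_le_mul_of_nonneg_left ?_ (Nat.cast_nonneg n))
    linarith

end

end CQGP

/-- The capacity region is the union, over all sequences of states of the Markov form (with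
arbitrary finite auxiliary alphabets), of the sets of rate pairs satisfying the two bounds. -/
theorem theorem3 {X S B : Type*} [Fintype X] [DecidableEq X] [Fintype S] [DecidableEq S]
    [Fintype B] [DecidableEq B] (N : CQGP.ChannelSeq X S B) :
    CQGP.capacityRegion N =
      {r : ℝ × ℝ | ∃ (t u : ℕ → ℕ) (P : ∀ n, CQGP.AuxKernels X S (Fin (t n)) (Fin (u n)) n),
        (r.1 : EReal) ≤ CQGP.infoUB N P - CQGP.infoUT N P ∧
        CQGP.infoST N P ≤ (r.2 : EReal)} := by
  ext r
  exact ⟨CQGP.exists_kernels_of_mem_capacityRegion N,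
    fun ⟨_, _, P, h1, h2⟩ => CQGP.mem_capacityRegion_of_le N P h1 h2⟩
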